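/- **Notation.** For $k,m>-1$ let $P_n^{k,m}$ be the Jacobi polynomials (orthogonal on $(-1,1)$ for the weight $(1-x)^k(1+x)^m$, $P_0^{k,m}=1$, standard normalization $P_n^{k,m}(1)=\binom{n+k}{n}$), and let $\mathcal Q_n^{0,m}(re^{i\theta})=e^{im\theta}r^{m}P_n^{0,m}(2r^2-1)$, $m,n\in\mathbb N_0$, be the Zernike polynomials on the closed unit disk $\mathbb D$. For $m\in\mathbb N_0$ let $V^{0,m}$ be the space $\ell^1(\mathbb N_0,\mathbb C)$ with norm $\|a\|_1=\sum_n|a_n|$, where $a=(a_n)_{n\ge0}$ is identified with the function $\mathcal M[a]=\sum_n a_n\mathcal Q_n^{0,m}$ on $\mathbb D$; $\|\cdot\|_1$ also denotes the associated operator norms. * For $a\in V^{0,m_1}$, $b\in V^{0,m_2}$, the product $a*b\in V^{0,m_1+m_2}$ is the coefficient sequence of the function $\mathcal M[a]\,\mathcal M[b]$. Put $G(U)=U*U$ and $DG(W)h=2\,W*h$. * $\triangle_0^{-1}$ is the inverse Dirichlet Laplacian on the disk, acting on coefficients with respect to $(\mathcal Q_n^{0,m})_n$ by $\triangle_0^{-1}\mathcal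 Q_0^{0,m}=\frac{\mathcal Q_1^{0,m}-\mathcal Q_0^{0,m}}{4(m+1)(m+2)}$ and, for $n\ge1$, $\triangle_0^{-1}\mathcal Q_n^{0,m}=\frac{\mathcal Q_{n+1}^{0,m}}{4(2n+m+1)(2n+m+2)}-\frac{\mathcal Q_n^{0,m}}{2(2n+m+2)(2n+m)}+\frac{\mathcal Q_{n-1}^{0,m}}{4(2n+m)(2n+m+1)}$. * $R^-:V^{0,m+1}\to V^{0,m}$ is multiplication by $\bar z$, i.e. $R^-\mathcal Q_n^{0,m+1}=\frac{n+1}{2n+m+2}\mathcal Q_{n+1}^{0,m}+\frac{n+m+1}{2n+m+2}\mathcal Q_n^{0,m}$, and $(R^-)^m:V^{0,2m}\to V^{0,m}$ is its $m$-fold composition. * $R^+_{0,0}$ and $R^+_{0,1}$ are multiplication by $z$ from wave number $0$ to $1$ and from wave number $1$ to $2$. Their inverses are given by the upper triangular matrices (entries for $j\ge i\ge0$, zero otherwise) $\big((R^+_{0,0})^{-1}\big)_{i,j}=(-1)^{i+j}\frac{2i+1}{j+1}$ and $\big((R^+_{0,1})^{-1}\big)_{i,j}=(-1)^{i+j}\frac{2(i+1)^2}{(j+1)(j+2)}$.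 (For $f\in V^{0,2}$ the sequence $(R^+_{0,1})^{-1}f$ need not be in $\ell^1$, but $\triangle_0^{-1}(R^+_{0,1})^{-1}f\in V^{0,1}$.) * $F_m:V^{0,|m|}\to V^{0,|m|}$ is $F_m(U)=U+\triangle_0^{-1}(R^-)^mG(U)$ for $m\in\mathbb N_0$, and $F_{-1}(U)=U+\triangle_0^{-1}(R^+_{0,1})^{-1}G(U)$. * $\pi^N$ is the truncation to the indices $n\le N$, and $\pi^\infty=I-\pi^N$. **Lemma.** Let $m\in\mathbb N_0\cup\{-1\}$ and $N\ge1$. Let $U_0\in V^{0,|m|}$ with $U_0=\pi^NU_0$, let $A^N:V^{0,|m|}\to V^{0,|m|}$ be a bounded linear operator with $A^N=\pi^NA^N\pi^N$, and put $A=A^N+\pi^\infty$. Let $Z_{0,m}\ge0$ satisfy $$Z_{0,m}\ \ge\ \begin{cases}\big\|\pi^N-A^N\big(I+\triangle_0^{-1}(R^-)^mDG(U_0)\pi^N\big)\big\|_1&\text{if } m\in\mathbb N_0,\\[2pt] \big\|\pi^N-A^N\big(I+\triangle_0^{-1}(R^+_{0,1})^{-1}DG(U_0)\big)\pi^N\big\|_1&\text{if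 } m=-1,\end{cases}$$ and let $Z_1\ge0$ satisfy $$Z_1\ \ge\ \begin{cases}\max\Big\{Z_{0,m},\ \big\|A^N\triangle_0^{-1}(R^-)^mDG(U_0)(\pi^{2N+m+1}-\pi^N)\big\|_1\Big\}+\dfrac{2\|U_0\|_1}{(2(N+1)+m)^2}&\text{if } m\in\mathbb N_0,\\[8pt] \max\Big\{Z_{0,-1},\ \big\|A^N\triangle_0^{-1}DG\big((R^+_{0,0})^{-1}U_0\big)(\pi^{2N+1}-\pi^N)\big\|_1\Big\}+\dfrac{\|(R^+_{0,0})^{-1}U_0\|_1}{2N^2}&\text{if } m=-1,\end{cases}$$ where for $m=-1$ the operator $DG\big((R^+_{0,0})^{-1}U_0\big)$ acts on $V^{0,1}$. Then $F_m$ is Fréchet differentiable at $U_0$ and $$\|I-A\,DF_m(U_0)\|_1\le Z_1 .$$ -/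

import Mathlib

open scoped NNReal ENNReal

noncomputable section

/-- The Jacobi polynomials `P_n^{k,m}`, orthogonal on `(-1,1)` for the weight
`(1-x)^k (1+x)^m`, `k, m > -1`, through their three-term recurrence
`P_{n+1} = (α_n x - β_n) P_n - γ_n P_{n-1}`, `P_0 = 1`, `P_{-1} = 0`.
The step `n = 0` is written after the cancellation
`α_0 = (k+m+2)/2`, `β_0 = (m-k)/2`. -/
def jacobiP (k m : ℝ) : ℕ → ℝ → ℝ
  | 0, _ => 1
  | 1, x => (k + m + 2) / 2 * x - (m - k) / 2
  | n + 2, x =>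
      let j : ℝ := (n : ℝ) + 1
      ((2 * j + k + m + 1) * (2 * j + k + m + 2) / (2 * (j + 1) * (j + k + m + 1)) * x
          - (m ^ 2 - k ^ 2) * (2 * j + k + m + 1) /
            (2 * (j + 1) * (j + k + m + 1) * (2 * j + k + m))) * jacobiP k m (n + 1) x
        - (j + k) * (j + m) * (2 * j + k + m + 2) /
            ((j + 1) * (j + k + m + 1) * (2 * j + k + m)) * jacobiP k m n x

/-- The Zernike polynomial `𝒬_n^{k,m}(r, θ) = e^{i m θ} r^{|m|} P_n^{k,|m|}(2 r² - 1)`, as a function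
of `z = r e^{i θ}`. -/
def zernikeQ (k : ℝ) (m : ℤ) (n : ℕ) (z : ℂ) : ℂ :=
  Complex.exp (Complex.I * (m : ℂ) * (Complex.arg z : ℂ)) * ((‖z‖ ^ m.natAbs : ℝ) : ℂ) *
    (jacobiP k (m.natAbs : ℝ) n (2 * ‖z‖ ^ 2 - 1) : ℂ)

/-- The space `V^{0,m}`, `m ≥ 0`, of absolutely summable sequences of coefficients with respect to
`𝒬_n^{0,m}`, `n ≥ 0`, with the `ℓ¹` norm (trivial weights). The index `m` only records the wave
number of the basis. -/
abbrev ZernikeV (_m : ℕ) : Type := lp (fun _ : ℕ => ℂ) 1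

/-- The transform `𝓜` on `V^{0,m}`: the function with given Zernike coefficients. -/
def zernikeSeries (m : ℕ) (a : ZernikeV m) (z : ℂ) : ℂ :=
  ∑' n : ℕ, a n * zernikeQ 0 (m : ℤ) n z

open Classical in
/-- The inverse transform `𝓜⁻¹` with values in `V^{0,m}`: the sequence of coefficients of the Zernike
series, of wave number `m`, that represents `u` on the closed unit disk
(`0` if there is none). -/
def zernikeCoeffs (m : ℕ) (u : ℂ → ℂ) : ZernikeV m :=
  if h : ∃ c : ZernikeV m, ∀ z ∈ Metric.closedBall (0 : ℂ) 1, zernikeSeries m c z = u z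
  then h.choose else 0

/-- The discrete convolution `a * b = 𝓜⁻¹ (𝓜[a] 𝓜[b])`, restricted to
`V^{0,m₁} × V^{0,m₂} → V^{0,m₁+m₂}`. -/
def zernikeConv (m₁ m₂ : ℕ) (a : ZernikeV m₁) (b : ZernikeV m₂) : ZernikeV (m₁ + m₂) :=
  zernikeCoeffs (m₁ + m₂) (fun z => zernikeSeries m₁ a z * zernikeSeries m₂ b z)

/-- The quadratic nonlinearity `G(U) = U * U`, restricted to `V^{0,m} → V^{0,2m}`. -/
def zernikeG (m : ℕ) (U : ZernikeV m) : ZernikeV (m + m) := zernikeConv m m U U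

/-- The derivative `DG(W) h = 2 W * h` of the nonlinearity `G(U) = U * U` at `W ∈ V^{0,m₁}`, in the
directions `h ∈ V^{0,m₂}`. -/
def zernikeDG (m₁ m₂ : ℕ) (W : ZernikeV m₁) (h : ZernikeV m₂) : ZernikeV (m₁ + m₂) :=
  (2 : ℂ) • zernikeConv m₁ m₂ W h

/-! ### Multiplication by `z` and `z̄` in the Zernike basis -/

theorem jacobiP_succ_succ (m : ℕ) (n : ℕ) (x : ℝ) :
    2 * ((n : ℝ) + 2) * (n + m + 2) * (2 * n + m + 2) * jacobiP 0 m (n + 2) x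
      = ((2 * n + m + 3) * (2 * n + m + 4) * (2 * n + m + 2) * x - m ^ 2 * (2 * n + m + 3)) *
          jacobiP 0 m (n + 1) x
        - 2 * ((n : ℝ) + 1) * (n + m + 1) * (2 * n + m + 4) * jacobiP 0 m n x := by
  have hn : (0 : ℝ) ≤ n := n.cast_nonneg
  have hm : (0 : ℝ) ≤ m := m.cast_nonneg
  rw [jacobiP]
  have h1 : (n : ℝ) + 1 + 1 ≠ 0 := by positivity
  have h2 : (n : ℝ) + 1 + 0 + m + 1 ≠ 0 := by positivity
  have h3 : 2 * ((n : ℝ) + 1) + 0 + m ≠ 0 := by positivity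
  field_simp
  ring

theorem jacobiP_ladder (m n : ℕ) (x : ℝ) :
    ((2 * (n : ℝ) + m + 1) * jacobiP 0 m n x
      = (n + m + 1) * jacobiP 0 ((m + 1 : ℕ) : ℝ) n x
        + n * jacobiP 0 ((m + 1 : ℕ) : ℝ) (n - 1) x) ∧
    ((2 * (n : ℝ) + m + 2) * ((1 + x) / 2) * jacobiP 0 ((m + 1 : ℕ) : ℝ) n x
      = (n + 1) * jacobiP 0 m (n + 1) x + (n + m + 1) * jacobiP 0 m n x) := by
  have hm : (0 : ℝ) ≤ m := m.cast_nonneg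
  induction n with
  | zero =>
    simp only [jacobiP]
    push_cast
    constructor <;> ring
  | succ n ih =>
    obtain ⟨ha, hb⟩ := ih
    have hn : (0 : ℝ) ≤ n := n.cast_nonneg
    have hA : (2 * ((n + 1 : ℕ) : ℝ) + m + 1) * jacobiP 0 m (n + 1) x
      = ((n + 1 : ℕ) + m + 1) * jacobiP 0 ((m + 1 : ℕ) : ℝ) (n + 1) x
        + (n + 1 : ℕ) * jacobiP 0 ((m + 1 : ℕ) : ℝ) n x := by
      cases n with
      | zero =>
        simp only [jacobiP]
        push_cast
        ring
      | succ n =>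
        have r := jacobiP_succ_succ (m + 1) n x
        simp only [Nat.add_sub_cancel] at ha
        push_cast at ha hb r ⊢
        have hn : (0 : ℝ) ≤ n := n.cast_nonneg
        have h0 : 2 * ((n : ℝ) + 2) * (2 * n + m + 3) ≠ 0 := by positivity
        apply mul_left_cancel₀ h0
        linear_combination (-2 * (2 * (n : ℝ) + m + 3) * (2 * n + m + 5)) * hb - r
          - 2 * ((n : ℝ) + m + 2) * (2 * n + m + 5) * ha
    refine ⟨by simpa using hA, ?_⟩
    have r := jacobiP_succ_succ m n x
    push_cast at hA hb r ⊢
    have h0 : 2 * ((n : ℝ) + m + 2) * (2 * n + m + 2) ≠ 0 := by positivity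
    apply mul_left_cancel₀ h0
    linear_combination (-2 * (2 * (n : ℝ) + m + 2) * (2 * n + m + 4) * ((1 + x) / 2)) * hA - r
      - 2 * (2 * (n : ℝ) + m + 4) * (n + 1) * hb

theorem zernikeQ_natCast (k : ℝ) (m n : ℕ) (z : ℂ) :
    zernikeQ k m n z = z ^ m * (jacobiP k m n (2 * ‖z‖ ^ 2 - 1) : ℂ) := by
  have h : z ^ m = (‖z‖ : ℂ) ^ m * Complex.exp (Complex.I * m * (Complex.arg z : ℂ)) := by
    conv_lhs => rw [← Complex.norm_mul_exp_arg_mul_I z]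
    rw [mul_pow, ← Complex.exp_nat_mul]
    congr 2
    ring
  rw [zernikeQ, h]
  simp only [Int.natAbs_natCast, Int.cast_natCast, Complex.ofReal_pow]
  ring

/-- The multiplication by `z` in the Zernike basis. -/
theorem mul_zernikeQ (m n : ℕ) (z : ℂ) :
    z * zernikeQ 0 m n z = ((n : ℂ) + m + 1) / (2 * n + m + 1) * zernikeQ 0 ((m + 1 : ℕ) : ℤ) n z
      + (n : ℂ) / (2 * n + m + 1) * zernikeQ 0 ((m + 1 : ℕ) : ℤ) (n - 1) z := by
  have h := congrArg (fun t : ℝ => (t : ℂ)) (jacobiP_ladder m n (2 * ‖z‖ ^ 2 - 1)).1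
  have h0 : 2 * (n : ℂ) + m + 1 ≠ 0 := by exact_mod_cast Nat.succ_ne_zero (2 * n + m)
  simp only [zernikeQ_natCast]
  push_cast at h ⊢
  apply mul_left_cancel₀ h0
  generalize hp : 2 * (n : ℂ) + m + 1 = p at h h0 ⊢
  field_simp
  linear_combination z ^ m * z * h

/-- The multiplication by `z̄` in the Zernike basis. -/
theorem conj_mul_zernikeQ (m n : ℕ) (z : ℂ) :
    (starRingEnd ℂ) z * zernikeQ 0 ((m + 1 : ℕ) : ℤ) n z
      = ((n : ℂ) + 1) / (2 * n + m + 2) * zernikeQ 0 m (n + 1) z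
        + ((n : ℂ) + m + 1) / (2 * n + m + 2) * zernikeQ 0 m n z := by
  have h := congrArg (fun t : ℝ => (t : ℂ)) (jacobiP_ladder m n (2 * ‖z‖ ^ 2 - 1)).2
  have h0 : 2 * (n : ℂ) + m + 2 ≠ 0 := by exact_mod_cast Nat.succ_ne_zero (2 * n + m + 1)
  have hz : (starRingEnd ℂ) z * z = (‖z‖ : ℂ) ^ 2 := Complex.conj_mul' z
  simp only [zernikeQ_natCast]
  push_cast at h ⊢
  apply mul_left_cancel₀ h0
  generalize hp : 2 * (n : ℂ) + m + 2 = p at h h0 ⊢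
  field_simp
  rw [pow_succ]
  generalize (jacobiP 0 ((m : ℝ) + 1) n (2 * ‖z‖ ^ 2 - 1) : ℂ) = J at h ⊢
  linear_combination z ^ m * h + p * z ^ m * J * hz

/-! ### Membership in `ℓ¹` -/

theorem memℓp_one_iff_summable (f : ℕ → ℂ) : Memℓp f 1 ↔ Summable fun n => ‖f n‖ := by
  simpa using memℓp_gen_iff (E := fun _ : ℕ => ℂ) (p := 1) (by simp) (f := f)

theorem ZernikeV.summable_norm {m : ℕ} (a : ZernikeV m) : Summable fun n => ‖a n‖ :=
  (memℓp_one_iff_summable _).1 (lp.memℓp a)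

/-! ### Truncations -/

/-- The truncation `π^N`, which keeps the coefficients of index `n ≤ N`. -/
def zernikeTrunc (m N : ℕ) : ZernikeV m →L[ℂ] ZernikeV m :=
  LinearMap.mkContinuous
    { toFun := fun a => ⟨fun n => if n ≤ N then a n else 0,
        (memℓp_one_iff_summable _).2 (by
          refine Summable.of_nonneg_of_le (fun _ => norm_nonneg _) (fun n => ?_) a.summable_norm
          split_ifs <;> simp)⟩
      map_add' := fun a b => by
        ext n
        change (if n ≤ N then a n + b n else 0)
          = (if n ≤ N then a n else 0) + (if n ≤ N then b n else 0)
        split_ifs <;> simp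
      map_smul' := fun c a => by
        ext n
        by_cases h : n ≤ N <;> simp [h] }
    1 (fun a => by
      rw [one_mul, lp.norm_eq_tsum_rpow (by simp), lp.norm_eq_tsum_rpow (by simp)]
      simp only [ENNReal.toReal_one, Real.rpow_one, div_one]
      have h1 : ∀ n, ‖(if n ≤ N then a n else 0 : ℂ)‖ ≤ ‖a n‖ := fun n => by
        split_ifs <;> simp
      exact Summable.tsum_le_tsum h1
        (Summable.of_nonneg_of_le (fun _ => norm_nonneg _) h1 a.summable_norm) a.summable_norm)

/-! ### The inverse Dirichlet Laplacian -/

/-- The coefficient of `𝒬_{n+1}^{0,m}` in `Δ₀⁻¹ 𝒬_n^{0,m}`. -/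
def invLapUp (m n : ℕ) : ℝ := 1 / (4 * (2 * n + m + 1) * (2 * n + m + 2))

/-- The coefficient of `𝒬_n^{0,m}` in `Δ₀⁻¹ 𝒬_n^{0,m}`. -/
def invLapDiag (m n : ℕ) : ℝ :=
  if n = 0 then -1 / (4 * (m + 1) * (m + 2)) else -1 / (2 * (2 * n + m + 2) * (2 * n + m))

/-- The coefficient of `𝒬_{n-1}^{0,m}` in `Δ₀⁻¹ 𝒬_n^{0,m}`, for `n ≥ 1`. -/
def invLapDown (m n : ℕ) : ℝ := 1 / (4 * (2 * n + m) * (2 * n + m + 1))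

/-- The inverse Laplacian `Δ₀⁻¹` with Dirichlet boundary conditions on the disk, on sequences of
coefficients with respect to `𝒬_n^{0,m}`: the linear extension of
`Δ₀⁻¹ 𝒬_0 = (𝒬_1 - 𝒬_0) / (4 (m+1) (m+2))` and, for `n ≥ 1`,
`Δ₀⁻¹ 𝒬_n = 𝒬_{n+1} / (4 (2n+m+1) (2n+m+2)) - 𝒬_n / (2 (2n+m+2) (2n+m))
  + 𝒬_{n-1} / (4 (2n+m) (2n+m+1))`. -/
def invLapSeq (m : ℕ) (x : ℕ → ℂ) (i : ℕ) : ℂ :=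
  (if i = 0 then 0 else (invLapUp m (i - 1) : ℂ) * x (i - 1)) + (invLapDiag m i : ℂ) * x i
    + (invLapDown m (i + 1) : ℂ) * x (i + 1)

theorem abs_invLapUp_le (m n : ℕ) : |invLapUp m n| ≤ 1 / ((n : ℝ) + 1) ^ 2 := by
  unfold invLapUp
  have hm : (0 : ℝ) ≤ m := m.cast_nonneg
  have hn : (0 : ℝ) ≤ n := n.cast_nonneg
  rw [abs_of_nonneg (by positivity)]
  apply one_div_le_one_div_of_le (by positivity)
  nlinarith [mul_nonneg hm hn, mul_nonneg hm hm, mul_nonneg hn hn]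

theorem abs_invLapDiag_le (m n : ℕ) : |invLapDiag m n| ≤ 1 / ((n : ℝ) + 1) ^ 2 := by
  unfold invLapDiag
  have hm : (0 : ℝ) ≤ m := m.cast_nonneg
  split_ifs with h
  · subst h
    rw [neg_div, abs_neg, abs_of_nonneg (by positivity)]
    apply one_div_le_one_div_of_le (by positivity)
    push_cast
    nlinarith [mul_nonneg hm hm]
  · have hn : (1 : ℝ) ≤ n := by exact_mod_cast Nat.one_le_iff_ne_zero.2 h
    rw [neg_div, abs_neg, abs_of_nonneg (by positivity)]
    apply one_div_le_one_div_of_le (by positivity)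
    nlinarith [mul_nonneg hm hm, mul_nonneg hm (by linarith : (0 : ℝ) ≤ n)]

theorem abs_invLapDown_le (m n : ℕ) (h : n ≠ 0) :
    |invLapDown m n| ≤ 1 / ((n : ℝ) + 1) ^ 2 := by
  unfold invLapDown
  have hm : (0 : ℝ) ≤ m := m.cast_nonneg
  have hn : (1 : ℝ) ≤ n := by exact_mod_cast Nat.one_le_iff_ne_zero.2 h
  rw [abs_of_nonneg (by positivity)]
  apply one_div_le_one_div_of_le (by positivity)
  nlinarith [mul_nonneg hm hm, mul_nonneg hm (by linarith : (0 : ℝ) ≤ n)]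

theorem memℓp_invLapSeq (m : ℕ) {x : ℕ → ℂ}
    (hx : Summable fun n : ℕ => 1 / ((n : ℝ) + 1) ^ 2 * ‖x n‖) : Memℓp (invLapSeq m x) 1 := by
  rw [memℓp_one_iff_summable]
  have key : ∀ (c : ℝ) (n : ℕ), |c| ≤ 1 / ((n : ℝ) + 1) ^ 2 →
      ‖(c : ℂ) * x n‖ ≤ 1 / ((n : ℝ) + 1) ^ 2 * ‖x n‖ := fun c n hc => by
    rw [norm_mul, Complex.norm_real, Real.norm_eq_abs]
    exact mul_le_mul_of_nonneg_right hc (norm_nonneg _)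
  have s1 : Summable fun i : ℕ =>
      ‖(if i = 0 then 0 else (invLapUp m (i - 1) : ℂ) * x (i - 1) : ℂ)‖ := by
    refine (summable_nat_add_iff 1).1 ?_
    simpa using Summable.of_nonneg_of_le (fun n => norm_nonneg ((invLapUp m n : ℂ) * x n))
      (fun n => key _ n (abs_invLapUp_le m n)) hx
  have s2 : Summable fun i : ℕ => ‖(invLapDiag m i : ℂ) * x i‖ :=
    Summable.of_nonneg_of_le (fun _ => norm_nonneg _)
      (fun n => key _ n (abs_invLapDiag_le m n)) hx
  have s3 : Summable fun i : ℕ => ‖(invLapDown m (i + 1) : ℂ) * x (i + 1)‖ :=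
    Summable.of_nonneg_of_le (fun _ => norm_nonneg _)
      (fun n => key _ (n + 1) (abs_invLapDown_le m (n + 1) (Nat.succ_ne_zero n)))
      ((summable_nat_add_iff 1).2 hx)
  exact Summable.of_nonneg_of_le (fun _ => norm_nonneg _) (fun i => norm_add₃_le)
    ((s1.add s2).add s3)

/-- `Δ₀⁻¹ : V^{0,m} → V^{0,m}`. -/
def invLap (m : ℕ) (a : ZernikeV m) : ZernikeV m :=
  ⟨invLapSeq m a, memℓp_invLapSeq m (by
    refine Summable.of_nonneg_of_le (fun _ => by positivity) (fun n => ?_) a.summable_norm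
    refine mul_le_of_le_one_left (norm_nonneg _) ?_
    rw [div_le_one (by positivity)]
    nlinarith [(n.cast_nonneg : (0 : ℝ) ≤ n)])⟩

/-! ### Multiplication by `z̄` -/

/-- `R⁻ : V^{0,m+1} → V^{0,m}`, the multiplication by `z̄`, on sequences of coefficients: the linear
extension of
`R⁻ 𝒬_n^{0,m+1} = (n+1)/(2n+m+2) 𝒬_{n+1}^{0,m} + (n+m+1)/(2n+m+2) 𝒬_n^{0,m}`. -/
def rMinusSeq (m : ℕ) (x : ℕ → ℂ) (i : ℕ) : ℂ :=
  (if i = 0 then 0 else (i : ℂ) / (2 * i + m) * x (i - 1))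
    + ((i : ℂ) + m + 1) / (2 * i + m + 2) * x i

theorem norm_ratCast_div_le_one {a b : ℝ} (ha : 0 ≤ a) (hab : a ≤ b) : ‖(a / b : ℂ)‖ ≤ 1 := by
  rw [norm_div, Complex.norm_real, Complex.norm_real, Real.norm_of_nonneg ha,
    Real.norm_of_nonneg (ha.trans hab)]
  exact div_le_one_of_le₀ hab (ha.trans hab)

theorem memℓp_rMinusSeq (m : ℕ) (a : ZernikeV (m + 1)) : Memℓp (rMinusSeq m a) 1 := by
  rw [memℓp_one_iff_summable]
  have hm : (0 : ℝ) ≤ m := m.cast_nonneg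
  have s1 : Summable fun i : ℕ =>
      ‖(if i = 0 then 0 else (i : ℂ) / (2 * i + m) * a (i - 1) : ℂ)‖ := by
    refine (summable_nat_add_iff 1).1 ?_
    refine Summable.of_nonneg_of_le (fun _ => norm_nonneg _) (fun n => ?_) a.summable_norm
    rw [if_neg (Nat.succ_ne_zero n), norm_mul]
    have hn : (0 : ℝ) ≤ n := n.cast_nonneg
    have := norm_ratCast_div_le_one (a := (n : ℝ) + 1) (b := 2 * ((n : ℝ) + 1) + m)
      (by positivity) (by linarith)
    refine mul_le_of_le_one_left (norm_nonneg _) ?_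
    push_cast at this ⊢
    exact this
  have s2 : Summable fun i : ℕ => ‖((i : ℂ) + m + 1) / (2 * i + m + 2) * a i‖ := by
    refine Summable.of_nonneg_of_le (fun _ => norm_nonneg _) (fun n => ?_) a.summable_norm
    rw [norm_mul]
    have hn : (0 : ℝ) ≤ n := n.cast_nonneg
    have := norm_ratCast_div_le_one (a := (n : ℝ) + m + 1) (b := 2 * (n : ℝ) + m + 2)
      (by positivity) (by linarith)
    refine mul_le_of_le_one_left (norm_nonneg _) ?_
    push_cast at this
    exact this
  exact Summable.of_nonneg_of_le (fun _ => norm_nonneg _) (fun i => norm_add_le _ _) (s1.add s2)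

/-- `R⁻ : V^{0,m+1} → V^{0,m}`. -/
def rMinus (m : ℕ) (a : ZernikeV (m + 1)) : ZernikeV m := ⟨rMinusSeq m a, memℓp_rMinusSeq m a⟩

/-- `(R⁻)^j : V^{0,m+j} → V^{0,m}`, the composition
`V^{0,m+j} → V^{0,m+j-1} → ⋯ → V^{0,m+1} → V^{0,m}`. -/
def rMinusPow (m : ℕ) : (j : ℕ) → ZernikeV (m + j) → ZernikeV m
  | 0, a => a
  | j + 1, a => rMinusPow m j (rMinus (m + j) a)

/-! ### Multiplication by `z` and its inverse -/

/-- `R⁺`, the multiplication by `z`, from coefficients with respect to `𝒬_n^{0,m}` to coefficients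
with respect to `𝒬_n^{0,m+1}`: the linear extension of
`R⁺ 𝒬_n^{0,m} = (n+m+1)/(2n+m+1) 𝒬_n^{0,m+1} + n/(2n+m+1) 𝒬_{n-1}^{0,m+1}`. -/
def rPlusSeq (m : ℕ) (x : ℕ → ℂ) (i : ℕ) : ℂ :=
  ((i : ℂ) + m + 1) / (2 * i + m + 1) * x i
    + ((i : ℂ) + 1) / (2 * (i + 1) + m + 1) * x (i + 1)

/-- The matrix of `(R⁺_{0,1})⁻¹`, from wave number `2` to wave number `1`. -/
def rPlusOneInvMat (i j : ℕ) : ℂ :=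
  if i ≤ j then (-1) ^ (j + i) * (2 * ((i : ℂ) + 1) ^ 2 / (((j : ℂ) + 1) * (j + 2))) else 0

/-- The matrix of `(R⁺_{0,0})⁻¹`, from wave number `1` to wave number `0`. -/
def rPlusZeroInvMat (i j : ℕ) : ℂ :=
  if i ≤ j then (-1) ^ (j + i) * ((2 * (i : ℂ) + 1) / ((j : ℂ) + 1)) else 0

/-- `(R⁺_{0,1})⁻¹ f` for `f ∈ V^{0,2}`. This sequence `x` need not be in `ℓ¹`, but
`∑ |x_i| / (2 i + 2)` is finite. -/
def rPlusOneInv (f : ZernikeV 2) (i : ℕ) : ℂ := ∑' j, rPlusOneInvMat i j * f j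

theorem norm_rPlusOneInvMat_le (i j : ℕ) :
    1 / ((i : ℝ) + 1) ^ 2 * ‖rPlusOneInvMat i j‖ ≤ 2 / (((i : ℝ) + 1) * (i + 2)) := by
  unfold rPlusOneInvMat
  split_ifs with h
  · have hij : (i : ℝ) ≤ j := by exact_mod_cast h
    have e : ‖((-1) ^ (j + i) * (2 * ((i : ℂ) + 1) ^ 2 / (((j : ℂ) + 1) * (j + 2))) : ℂ)‖
        = 2 * ((i : ℝ) + 1) ^ 2 / (((j : ℝ) + 1) * (j + 2)) := by
      rw [norm_mul, norm_pow, norm_neg, norm_one, one_pow, one_mul]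
      have : (2 * ((i : ℂ) + 1) ^ 2 / (((j : ℂ) + 1) * (j + 2)) : ℂ)
          = ((2 * ((i : ℝ) + 1) ^ 2 / (((j : ℝ) + 1) * (j + 2)) : ℝ) : ℂ) := by push_cast; ring
      rw [this, Complex.norm_real, Real.norm_of_nonneg (by positivity)]
    rw [e]
    have e2 : 1 / ((i : ℝ) + 1) ^ 2 * (2 * ((i : ℝ) + 1) ^ 2 / (((j : ℝ) + 1) * (j + 2)))
        = 2 / (((j : ℝ) + 1) * (j + 2)) := by
      field_simp
    rw [e2]
    gcongr
  · simp only [norm_zero, mul_zero]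
    positivity

theorem summable_rPlusOneInvMat_mul (f : ZernikeV 2) (i : ℕ) :
    Summable fun j => rPlusOneInvMat i j * f j := by
  refine Summable.of_norm_bounded (f.summable_norm.mul_left
    (2 / (((i : ℝ) + 1) * (i + 2)) * ((i : ℝ) + 1) ^ 2)) (fun j => ?_)
  rw [norm_mul]
  refine mul_le_mul_of_nonneg_right ?_ (norm_nonneg _)
  have := norm_rPlusOneInvMat_le i j
  rw [div_mul_eq_mul_div, one_mul, div_le_iff₀ (by positivity)] at this
  exact this

/-- `(R⁺_{0,1})⁻¹ f` is a preimage of `f` under `R⁺_{0,1}`. -/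
theorem rPlusSeq_rPlusOneInv (f : ZernikeV 2) : rPlusSeq 1 (rPlusOneInv f) = f := by
  funext i
  unfold rPlusSeq rPlusOneInv
  rw [← tsum_mul_left, ← tsum_mul_left, ← Summable.tsum_add
    ((summable_rPlusOneInvMat_mul f i).mul_left _)
    ((summable_rPlusOneInvMat_mul f (i + 1)).mul_left _), tsum_eq_single i]
  · have h1 : (i : ℂ) + 1 ≠ 0 := by exact_mod_cast Nat.succ_ne_zero i
    have h2 : (i : ℂ) + 2 ≠ 0 := by exact_mod_cast Nat.succ_ne_zero (i + 1)
    have e1 : 2 * (i : ℂ) + 1 + 1 = 2 * (i + 1) := by ring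
    rw [rPlusOneInvMat, rPlusOneInvMat, if_pos le_rfl, if_neg (by omega),
      Even.neg_one_pow ⟨i, rfl⟩]
    push_cast
    rw [e1]
    field_simp
    ring
  · intro j hj
    rcases lt_or_gt_of_ne hj with h | h
    · simp [rPlusOneInvMat, show ¬ i ≤ j by omega, show ¬ i + 1 ≤ j by omega]
    · have h1 : (i : ℂ) + 1 ≠ 0 := by exact_mod_cast Nat.succ_ne_zero i
      have h2 : (i : ℂ) + 2 ≠ 0 := by exact_mod_cast Nat.succ_ne_zero (i + 1)
      have e1 : 2 * (i : ℂ) + 1 + 1 = 2 * (i + 1) := by ring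
      have e2 : 2 * ((i : ℂ) + 1) + 1 + 1 = 2 * (i + 2) := by ring
      have h5 : (j : ℂ) + 1 ≠ 0 := by exact_mod_cast Nat.succ_ne_zero j
      have h6 : (j : ℂ) + 2 ≠ 0 := by exact_mod_cast Nat.succ_ne_zero (j + 1)
      rw [rPlusOneInvMat, rPlusOneInvMat, if_pos (show i ≤ j by omega),
        if_pos (show i + 1 ≤ j by omega), ← add_assoc, pow_succ]
      push_cast
      rw [e1, e2]
      field_simp
      ring

/-- The composition `Δ₀⁻¹ (R⁺_{0,1})⁻¹ : V^{0,2} → V^{0,1}`. -/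
def invLapRPlusOneInv (f : ZernikeV 2) : ZernikeV 1 :=
  ⟨invLapSeq 1 (rPlusOneInv f), memℓp_invLapSeq 1 (by
    have hs : Summable fun n : ℕ => (∑' j, ‖f j‖) * 2 * (1 / ((n : ℝ) + 1) ^ 2) := by
      have h0 := (summable_nat_add_iff 1).2 (Real.summable_one_div_nat_pow.2 one_lt_two)
      push_cast at h0
      exact h0.mul_left _
    refine Summable.of_nonneg_of_le (fun _ => by positivity) (fun i => ?_) hs
    have h1 : ‖rPlusOneInv f i‖ ≤ ∑' j, ‖rPlusOneInvMat i j * f j‖ :=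
      norm_tsum_le_tsum_norm (summable_rPlusOneInvMat_mul f i).norm
    have h2 : 1 / ((i : ℝ) + 1) ^ 2 * ∑' j, ‖rPlusOneInvMat i j * f j‖
        ≤ ∑' j, 2 / (((i : ℝ) + 1) * (i + 2)) * ‖f j‖ := by
      rw [← tsum_mul_left]
      refine Summable.tsum_le_tsum (fun j => ?_)
        ((summable_rPlusOneInvMat_mul f i).norm.mul_left _) (f.summable_norm.mul_left _)
      rw [norm_mul, ← mul_assoc]
      exact mul_le_mul_of_nonneg_right (norm_rPlusOneInvMat_le i j) (norm_nonneg _)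
    rw [tsum_mul_left] at h2
    have h3 : 2 / (((i : ℝ) + 1) * (i + 2)) ≤ 2 * (1 / ((i : ℝ) + 1) ^ 2) := by
      rw [← mul_div_assoc, mul_one, pow_two]
      gcongr
      norm_num
    have h4 : 0 ≤ ∑' j, ‖f j‖ := tsum_nonneg fun _ => norm_nonneg _
    calc 1 / ((i : ℝ) + 1) ^ 2 * ‖rPlusOneInv f i‖
        ≤ 1 / ((i : ℝ) + 1) ^ 2 * ∑' j, ‖rPlusOneInvMat i j * f j‖ := by gcongr
      _ ≤ _ := h2
      _ ≤ 2 * (1 / ((i : ℝ) + 1) ^ 2) * ∑' j, ‖f j‖ := by gcongr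
      _ = _ := by ring)⟩

/-- `(R⁺_{0,0})⁻¹ U ∈ V^{0,0}` for a finite sequence `U = π^N U ∈ V^{0,1}`. -/
def rPlusZeroInv (N : ℕ) (U : ZernikeV 1) (hU : zernikeTrunc 1 N U = U) : ZernikeV 0 :=
  ⟨fun i => ∑' j, rPlusZeroInvMat i j * U j, (memℓp_one_iff_summable _).2 (by
    refine summable_of_ne_finset_zero (s := Finset.range (N + 1)) (fun i hi => ?_)
    rw [norm_eq_zero]
    convert tsum_zero with j
    by_cases h : i ≤ j
    · have hj : ¬ j ≤ N := by
        rw [Finset.mem_range] at hi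
        omega
      have : U j = 0 := by
        rw [← hU]
        exact if_neg hj
      rw [this, mul_zero]
    · rw [rPlusZeroInvMat, if_neg h, zero_mul])⟩

/-- `(R⁺_{0,0})⁻¹ U` is a preimage of `U` under `R⁺_{0,0}`. -/
theorem rPlusSeq_rPlusZeroInv (N : ℕ) (U : ZernikeV 1) (hU : zernikeTrunc 1 N U = U) :
    rPlusSeq 0 (rPlusZeroInv N U hU) = U := by
  have hs : ∀ i, Summable fun j => rPlusZeroInvMat i j * U j := fun i => by
    refine summable_of_ne_finset_zero (s := Finset.range (N + 1)) (fun j hj => ?_)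
    have hj : ¬ j ≤ N := by
      rw [Finset.mem_range] at hj
      omega
    have : U j = 0 := by
      rw [← hU]
      exact if_neg hj
    rw [this, mul_zero]
  funext i
  unfold rPlusSeq
  change _ * (∑' j, rPlusZeroInvMat i j * U j) + _ * (∑' j, rPlusZeroInvMat (i + 1) j * U j) = _
  rw [← tsum_mul_left, ← tsum_mul_left, ← Summable.tsum_add
    ((hs i).mul_left _) ((hs (i + 1)).mul_left _), tsum_eq_single i]
  · have h1 : (i : ℂ) + 1 ≠ 0 := by exact_mod_cast Nat.succ_ne_zero i
    have h3 : 2 * (i : ℂ) + 1 ≠ 0 := by exact_mod_cast Nat.succ_ne_zero (2 * i)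
    rw [rPlusZeroInvMat, rPlusZeroInvMat, if_pos le_rfl, if_neg (by omega),
      Even.neg_one_pow ⟨i, rfl⟩, Nat.cast_zero, add_zero, add_zero]
    generalize 2 * (i : ℂ) + 1 = p at h3 ⊢
    field_simp
    ring
  · intro j hj
    rcases lt_or_gt_of_ne hj with h | h
    · simp [rPlusZeroInvMat, show ¬ i ≤ j by omega, show ¬ i + 1 ≤ j by omega]
    · have h3 : 2 * (i : ℂ) + 1 ≠ 0 := by exact_mod_cast Nat.succ_ne_zero (2 * i)
      have h4 : 2 * ((i : ℂ) + 1) + 1 ≠ 0 := by exact_mod_cast Nat.succ_ne_zero (2 * (i + 1))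
      have h5 : (j : ℂ) + 1 ≠ 0 := by exact_mod_cast Nat.succ_ne_zero j
      rw [rPlusZeroInvMat, rPlusZeroInvMat, if_pos (show i ≤ j by omega),
        if_pos (show i + 1 ≤ j by omega), ← add_assoc, pow_succ]
      push_cast
      rw [add_zero, add_zero, add_zero]
      generalize 2 * (i : ℂ) + 1 = p at h3 ⊢
      generalize 2 * ((i : ℂ) + 1) + 1 = q at h4 ⊢
      field_simp
      ring

/-! ### The zero-finding maps and the operator norm -/

/-- `F_m(U) = U + Δ₀⁻¹ (R⁻)^m (U * U)` on `V^{0,m}`, for `m ≥ 0`. -/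
def zernikeF (m : ℕ) (U : ZernikeV m) : ZernikeV m :=
  U + invLap m (rMinusPow m m (zernikeG m U))

/-- `F_{-1}(U) = U + Δ₀⁻¹ (R⁺_{0,1})⁻¹ (U * U)` on `V^{0,1}`. -/
def zernikeFNegOne (U : ZernikeV 1) : ZernikeV 1 :=
  U + invLapRPlusOneInv (zernikeG 1 U)

/-- The operator norm `‖T‖₁`, the supremum of `‖T h‖₁` over the unit ball, as an element
of `[0, ∞]`. -/
def l1OpNorm {m₁ m₂ : ℕ} (T : ZernikeV m₁ → ZernikeV m₂) : ℝ≥0∞ :=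
  ⨆ (h : ZernikeV m₁) (_ : ‖h‖ ≤ 1), ‖T h‖ₑ

/-- The approximate inverse `A = A^N + π^∞`, where `π^∞ = I - π^N`. -/
def approxInv (m N : ℕ) (AN : ZernikeV m →L[ℂ] ZernikeV m) : ZernikeV m →L[ℂ] ZernikeV m :=
  AN + (ContinuousLinearMap.id ℂ (ZernikeV m) - zernikeTrunc m N)

/-- The linearized nonlinear term `Δ₀⁻¹ (R⁻)^m DG(U₀)` on `V^{0,m}`, for `m ≥ 0`. -/
def linTerm (m : ℕ) (U₀ h : ZernikeV m) : ZernikeV m :=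
  invLap m (rMinusPow m m (zernikeDG m m U₀ h))

/-- The linearized nonlinear term `Δ₀⁻¹ (R⁺_{0,1})⁻¹ DG(U₀)` on `V^{0,1}`. -/
def linTermNegOne (U₀ h : ZernikeV 1) : ZernikeV 1 :=
  invLapRPlusOneInv (zernikeDG 1 1 U₀ h)

end

/-! Let `T` be the linear part of the nonlinearity, so that `DF_m(U₀) = I + T`. Write `h = p + q`
with `p = π^N h`. Since `A^N` only sees and produces indices at most `N`, the vector `(I - A(I + T))
h` splits as `(p - A^N(p + T p)) - A^N T q - π^∞ T h`. The first two terms are controlled by the two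
computable norms. They act on complementary parts of `h`, and `‖p‖ + ‖q‖ = ‖h‖` in `ℓ¹`, so only the
maximum of the two norms enters. Two analytic facts finish the estimate:

(a) `T` lowers the index by a bounded amount, so in `A^N T q` only finitely many coefficients of `q`
matter. Orthogonality of the radial polynomials gives a lowering of at most `N + m` for
multiplication by `U₀`, multiplication by `z̄` never lowers the index, and `Δ₀⁻¹` lowers it by one.
Hence the cut-off `2N + m + 1`.

(b) `π^∞ T` is small: the columns of `π^∞ Δ₀⁻¹` have `ℓ¹` norm at most `(2(N+1)+m)⁻²`, those of `R⁻`
have norm one, and `‖a * b‖ ≤ ‖a‖ ‖b‖`.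

The deep ingredient is the Banach algebra inequality in (b). It holds because a product of two
Zernike polynomials is a convex combination of Zernike polynomials: the coefficients sum to one by
evaluation at `z = 1`, and they are nonnegative because triple products have nonnegative integral.
For the latter, `𝒬_n^{0,m}` is a diagonal matrix coefficient of a symmetric power of `SU(2)`.
Multiplicativity of symmetric powers gives an addition formula with positive weights, and averaging
it turns the triple integral into a positive combination of squares (`zernikeQ_add_formula`,
`integral_radialPoly_mul_mul_nonneg`, `exists_linearization`).

For `m = -1`, write `U₀ = z W` with `W = (R⁺_{0,0})⁻¹ U₀`. Then `(R⁺_{0,1})⁻¹ DG(U₀) = DG(W)` on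
`V^{0,1}`, and the argument above applies to `T = Δ₀⁻¹ DG(W)` (`linTermNegOne_eq`). -/

noncomputable section

/-! ### Symmetric powers of two by two matrices -/

open Polynomial in
/-- The matrix entries of the `d`-th symmetric power of the matrix `!![α, β; γ, δ]`, in the basis
of monomials. -/
def symPowEntry {R : Type*} [CommRing R] (d i j : ℕ) (α β γ δ : R) : R :=
  ((C α * X + C β) ^ i * (C γ * X + C δ) ^ (d - i)).coeff j

-- Substitution of `x`, `y` for the two variables of the homogenized polynomial. With polynomials as
-- values of `x`, `y`, this is what makes symmetric powers multiplicative.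
open Polynomial in
theorem sum_coeff_mul_pow_mul_pow {R : Type*} [CommRing R] (α β γ δ : R) (x y : R[X]) (n i : ℕ) :
    ∑ k ∈ Finset.range (n + i + 1),
      C (((C α * X + C β) ^ i * (C γ * X + C δ) ^ n).coeff k) * x ^ k * y ^ (n + i - k)
      = (C α * x + C β * y) ^ i * (C γ * x + C δ * y) ^ n := by
  -- Homogenization in degree `d + 1` of a linear factor times `P` is the product of the
  -- homogenizations; both inductions below peel off one factor at a time.
  have key : ∀ (a b : R) (d : ℕ) (P : R[X]), P.natDegree ≤ d →
      ∑ k ∈ Finset.range (d + 1 + 1),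
        C (((C a * X + C b) * P).coeff k) * x ^ k * y ^ (d + 1 - k)
      = (C a * x + C b * y) * ∑ k ∈ Finset.range (d + 1), C (P.coeff k) * x ^ k * y ^ (d - k) := by
    intro a b d P hP
    have e1 : ∀ k, ((C a * X + C b) * P).coeff (k + 1) = a * P.coeff k + b * P.coeff (k + 1) := by
      intro k
      rw [add_mul, coeff_add, mul_assoc, coeff_C_mul, coeff_X_mul, coeff_C_mul]
    have e0 : ((C a * X + C b) * P).coeff 0 = b * P.coeff 0 := by
      simp [mul_coeff_zero]
    have e2 : ∀ k ∈ Finset.range (d + 1),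
        C (((C a * X + C b) * P).coeff (k + 1)) * x ^ (k + 1) * y ^ (d + 1 - (k + 1))
        = C a * x * (C (P.coeff k) * x ^ k * y ^ (d - k))
          + C b * (C (P.coeff (k + 1)) * x ^ (k + 1) * y ^ (d - k)) := by
      intro k _
      rw [e1, Nat.add_sub_add_right, C_add, C_mul, C_mul]
      ring
    have e3 : ∀ k ∈ Finset.range d, C b * (C (P.coeff (k + 1)) * x ^ (k + 1) * y ^ (d - k))
        = C b * y * (C (P.coeff (k + 1)) * x ^ (k + 1) * y ^ (d - (k + 1))) := by
      intro k hk
      rw [Finset.mem_range] at hk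
      rw [show d - k = d - (k + 1) + 1 by omega]
      ring
    have e4 : ∑ k ∈ Finset.range (d + 1), C b * (C (P.coeff (k + 1)) * x ^ (k + 1) * y ^ (d - k))
        = C b * y * ∑ k ∈ Finset.range d, C (P.coeff (k + 1)) * x ^ (k + 1) * y ^ (d - (k + 1)) := by
      rw [Finset.sum_range_succ, coeff_eq_zero_of_natDegree_lt (Nat.lt_succ_of_le hP),
        Finset.sum_congr rfl e3, Finset.mul_sum]
      simp
    have e5 : ∑ k ∈ Finset.range (d + 1), C (P.coeff k) * x ^ k * y ^ (d - k)
        = ∑ k ∈ Finset.range d, C (P.coeff (k + 1)) * x ^ (k + 1) * y ^ (d - (k + 1))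
          + C (P.coeff 0) * x ^ 0 * y ^ (d - 0) := Finset.sum_range_succ' _ _
    rw [Finset.sum_range_succ', e0, Finset.sum_congr rfl e2, Finset.sum_add_distrib,
      ← Finset.mul_sum, e4, add_mul (C a * x), e5, C_mul]
    simp only [Nat.sub_zero, pow_zero]
    ring
  have hdeg : ∀ (a b : R) (e : ℕ), ((C a * X + C b) ^ e).natDegree ≤ e := fun a b e => by
    refine natDegree_pow_le.trans ?_
    exact (Nat.mul_le_mul_left e (natDegree_linear_le)).trans (by simp)
  induction i with
  | zero =>
    induction n with
    | zero => simp
    | succ n ih =>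
      have := key γ δ n ((C γ * X + C δ) ^ n) (hdeg _ _ _)
      simp only [pow_zero, one_mul, add_zero] at ih ⊢
      rw [ih, ← pow_succ', ← pow_succ'] at this
      exact this
  | succ i ih =>
    have hP : ((C α * X + C β) ^ i * (C γ * X + C δ) ^ n).natDegree ≤ n + i := by
      refine natDegree_mul_le.trans ?_
      rw [add_comm]
      exact add_le_add (hdeg _ _ _) (hdeg _ _ _)
    have := key α β (n + i) _ hP
    rw [ih, ← mul_assoc, ← mul_assoc, ← pow_succ', ← pow_succ'] at this
    exact this

open Polynomial in
/-- The symmetric power of `g * diag(v, w) * h`. -/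
theorem symPowEntry_mul {R : Type*} [CommRing R] {d i : ℕ} (hi : i ≤ d) (l : ℕ)
    (α β γ δ α' β' γ' δ' v w : R) :
    symPowEntry d i l (α * v * α' + β * w * γ') (α * v * β' + β * w * δ')
        (γ * v * α' + δ * w * γ') (γ * v * β' + δ * w * δ')
      = ∑ k ∈ Finset.range (d + 1), symPowEntry d i k α β γ δ * (v ^ k * w ^ (d - k)) *
          symPowEntry d k l α' β' γ' δ' := by
  -- The two variables are replaced by the rows of `diag(v, w) * h`, read as linear polynomials; the
  -- identity is then the coefficient of `X ^ l`.
  have h := sum_coeff_mul_pow_mul_pow α β γ δ (C v * (C α' * X + C β')) (C w * (C γ' * X + C δ'))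
    (d - i) i
  rw [Nat.sub_add_cancel hi] at h
  have h2 := congrArg (fun P : R[X] => P.coeff l) h
  simp only [finsetSum_coeff] at h2
  unfold symPowEntry
  convert h2.symm using 1
  · congr 3
    · simp only [map_add, map_mul]; ring
    · simp only [map_add, map_mul]; ring
  · refine Finset.sum_congr rfl fun k _ => ?_
    have e : ∀ (t : R) (P Q : R[X]), C t * (C v * P) ^ k * (C w * Q) ^ (d - k)
        = C (t * (v ^ k * w ^ (d - k))) * (P ^ k * Q ^ (d - k)) := fun t P Q => by
      simp only [map_mul, map_pow]
      ring
    rw [e, coeff_C_mul]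

open Polynomial in
theorem coeff_linear_pow {R : Type*} [CommRing R] (a b : R) (n k : ℕ) :
    ((C a * X + C b) ^ n).coeff k = a ^ k * b ^ (n - k) * n.choose k := by
  have : (C a * X + C b) ^ n = ((X + C b) ^ n).comp (C a * X) := by simp
  rw [this, comp_C_mul_X_coeff, coeff_X_add_C_pow]
  ring

theorem symPowEntry_eq_sum {R : Type*} [CommRing R] (d i j : ℕ) (α β γ δ : R) :
    symPowEntry d i j α β γ δ = ∑ x ∈ Finset.range (j + 1),
      (i.choose x * (d - i).choose (j - x) : ℕ) * (α ^ x * β ^ (i - x) * γ ^ (j - x) *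
        δ ^ (d - i - (j - x))) := by
  rw [symPowEntry, Polynomial.coeff_mul, Finset.Nat.sum_antidiagonal_eq_sum_range_succ_mk]
  refine Finset.sum_congr rfl fun x _ => ?_
  rw [coeff_linear_pow, coeff_linear_pow]
  push_cast
  ring

/-- The symmetric power of the transpose. -/
theorem choose_mul_symPowEntry {R : Type*} [CommRing R] {d i j : ℕ} (hi : i ≤ d) (hj : j ≤ d)
    (α β γ δ : R) :
    (d.choose i : R) * symPowEntry d i j α β γ δ = d.choose j * symPowEntry d j i α γ β δ := by
  -- The sum is put on an index range symmetric in `i` and `j`: the condition says that the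
  -- exponents of all four entries are nonnegative.
  have key : ∀ {i j : ℕ}, i ≤ d → j ≤ d → ∀ (α β γ δ : R),
      (d.choose i : R) * symPowEntry d i j α β γ δ
        = ∑ x ∈ Finset.range (d + 1), if x ≤ i ∧ x ≤ j ∧ i + j ≤ d + x then
            (d.choose i * (i.choose x * (d - i).choose (j - x)) : ℕ) *
            (α ^ x * β ^ (i - x) * γ ^ (j - x) * δ ^ (d - i - (j - x))) else 0 := by
    intro i j hi hj α β γ δ
    rw [symPowEntry_eq_sum, Finset.mul_sum]
    have hsub : Finset.range (j + 1) ⊆ Finset.range (d + 1) :=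
      Finset.range_subset_range.2 (by omega)
    rw [← Finset.sum_subset hsub]
    · refine Finset.sum_congr rfl fun x hx => ?_
      rw [Finset.mem_range] at hx
      split_ifs with h
      · push_cast; ring
      · have : i.choose x * (d - i).choose (j - x) = 0 := by
          by_cases h1 : x ≤ i
          · rw [Nat.choose_eq_zero_of_lt (show d - i < j - x by omega), mul_zero]
          · rw [Nat.choose_eq_zero_of_lt (show i < x by omega), zero_mul]
        rw [this]; simp
    · intro x _ hx
      rw [Finset.mem_range] at hx
      rw [if_neg (by omega)]
  rw [key hi hj, key hj hi]
  refine Finset.sum_congr rfl fun x _ => ?_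
  by_cases h : x ≤ i ∧ x ≤ j ∧ i + j ≤ d + x
  · rw [if_pos h, if_pos (by omega)]
    obtain ⟨h1, h2, h3⟩ := h
    have e : d - i - (j - x) = d - j - (i - x) := by omega
    -- Both sides are the multinomial coefficient of `x`, `i - x`, `j - x`, `d - i - (j - x)`.
    have hc : d.choose i * (i.choose x * (d - i).choose (j - x))
        = d.choose j * (j.choose x * (d - j).choose (i - x)) := by
      have f1 := Nat.choose_mul_factorial_mul_factorial hi
      have f2 := Nat.choose_mul_factorial_mul_factorial hj
      have f3 := Nat.choose_mul_factorial_mul_factorial h1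
      have f4 := Nat.choose_mul_factorial_mul_factorial h2
      have f5 := Nat.choose_mul_factorial_mul_factorial (show j - x ≤ d - i by omega)
      have f6 := Nat.choose_mul_factorial_mul_factorial (show i - x ≤ d - j by omega)
      rw [← e] at f6
      have hp : 0 < x.factorial * (i - x).factorial * (j - x).factorial *
        (d - i - (j - x)).factorial := by positivity
      apply Nat.eq_of_mul_eq_mul_right hp
      calc _ = d.choose i * (i.choose x * x.factorial * (i - x).factorial) *
            ((d - i).choose (j - x) * (j - x).factorial * (d - i - (j - x)).factorial) := by ring
        _ = d.choose j * (j.choose x * x.factorial * (j - x).factorial) *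
            ((d - j).choose (i - x) * (i - x).factorial * (d - i - (j - x)).factorial) := by
          rw [f3, f4, f5, f6, f1, f2]
        _ = _ := by ring
    rw [hc, e]
    ring
  · rw [if_neg h, if_neg (by omega)]

theorem symPowEntry_map {R S : Type*} [CommRing R] [CommRing S] (f : R →+* S) (d i j : ℕ)
    (α β γ δ : R) :
    symPowEntry d i j (f α) (f β) (f γ) (f δ) = f (symPowEntry d i j α β γ δ) := by
  simp [symPowEntry_eq_sum]

/-- Reversing the order of summation makes the summation index the exponent of `β * γ`, which is the
shape of the explicit formula for the radial polynomials. -/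
theorem symPowEntry_diag {R : Type*} [CommRing R] (n m : ℕ) (α β γ δ : R) :
    symPowEntry (2 * n + m) (n + m) (n + m) α β γ δ = ∑ j ∈ Finset.range (n + 1),
      ((n + m).choose j * n.choose j : ℕ) * (α ^ (n + m - j) * δ ^ (n - j) * (β * γ) ^ j) := by
  rw [symPowEntry_eq_sum, ← Finset.sum_range_reflect,
    ← Finset.sum_subset (Finset.range_subset_range.2 (show n + 1 ≤ n + m + 1 by omega))]
  · refine Finset.sum_congr rfl fun j hj => ?_
    rw [Finset.mem_range] at hj
    have e1 : n + m + 1 - 1 - j = n + m - j := by omega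
    have e2 : n + m - (n + m - j) = j := by omega
    have e3 : 2 * n + m - (n + m) = n := by omega
    rw [e1, e2, e3, Nat.choose_symm (by omega), mul_pow]
    ring
  · intro j hj hj'
    rw [Finset.mem_range] at hj hj'
    rw [Nat.choose_eq_zero_of_lt
      (show 2 * n + m - (n + m) < n + m - (n + m + 1 - 1 - j) by omega)]
    simp

/-! ### Beta integrals and Fourier averages over the circle -/

theorem integral_pow_mul_one_sub_pow (a b : ℕ) :
    ∫ u in (0 : ℝ)..1, u ^ a * (1 - u) ^ b
      = (a.factorial * b.factorial : ℝ) / (a + b + 1).factorial := by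
  induction b generalizing a with
  | zero =>
    have : ((a : ℝ) + 1) ≠ 0 := by positivity
    have : (a.factorial : ℝ) ≠ 0 := by positivity
    simp [Nat.factorial_succ]
    field_simp
  | succ b ih =>
    -- Integration by parts: this primitive vanishes at both ends, so a power of `1 - u` is traded
    -- for a power of `u`.
    have hderiv : ∀ x ∈ Set.uIcc (0 : ℝ) 1, HasDerivAt (fun u : ℝ => u ^ (a + 1) * (1 - u) ^ (b + 1))
        ((a + 1) * (x ^ a * (1 - x) ^ (b + 1)) - (b + 1) * (x ^ (a + 1) * (1 - x) ^ b)) x := by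
      intro x _
      have h1 := hasDerivAt_pow (a + 1) x
      have h2 := ((hasDerivAt_id x).const_sub 1).pow (b + 1)
      refine (h1.mul h2).congr_deriv ?_
      simp only [Nat.add_sub_cancel, id, Pi.pow_apply]
      push_cast
      ring
    have hint := intervalIntegral.integral_eq_sub_of_hasDerivAt hderiv
      (Continuous.intervalIntegrable (by fun_prop) _ _)
    rw [intervalIntegral.integral_sub (Continuous.intervalIntegrable (by fun_prop) _ _)
      (Continuous.intervalIntegrable (by fun_prop) _ _), intervalIntegral.integral_const_mul,
      intervalIntegral.integral_const_mul, ih (a + 1)] at hint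
    have ha : ((a : ℝ) + 1) ≠ 0 := by positivity
    apply mul_left_cancel₀ ha
    have e : a + 1 + b + 1 = a + (b + 1) + 1 := by ring
    rw [e] at hint
    simp only [one_pow, sub_self, zero_pow (Nat.succ_ne_zero _), zero_mul, mul_zero] at hint
    rw [sub_eq_zero.1 hint, Nat.factorial_succ a, Nat.factorial_succ b]
    push_cast
    ring

open Complex in
theorem integral_exp_I_zpow (n : ℤ) :
    ∫ θ in (0 : ℝ)..(2 * Real.pi), exp (θ * I) ^ n = if n = 0 then (2 * Real.pi : ℂ) else 0 := by
  split_ifs with h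
  · subst h
    simp
  · have hc : (n : ℂ) * I ≠ 0 := mul_ne_zero (by exact_mod_cast h) I_ne_zero
    have : ∀ θ : ℝ, exp (θ * I) ^ n = exp ((n : ℂ) * I * θ) := fun θ => by
      rw [← exp_int_mul]
      congr 1
      ring
    simp_rw [this]
    rw [integral_exp_mul_complex hc]
    have h1 : (n : ℂ) * I * ((2 * Real.pi : ℝ) : ℂ) = n * (2 * Real.pi * I) := by push_cast; ring
    rw [h1, exp_int_mul_two_pi_mul_I]
    simp

/-- The constant coefficient of a Laurent polynomial on the unit circle is well defined. -/
theorem sum_filter_eq_of_forall_unit {ι κ : Type} (s : Finset ι) (t : Finset κ) (c : ι → ℂ)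
    (c' : κ → ℂ) (e : ι → ℤ) (e' : κ → ℤ)
    (h : ∀ w : ℂ, ‖w‖ = 1 → ∑ i ∈ s, c i * w ^ e i = ∑ i ∈ t, c' i * w ^ e' i) :
    ∑ i ∈ s with e i = 0, c i = ∑ i ∈ t with e' i = 0, c' i := by
  have key : ∀ {ι : Type} (s : Finset ι) (c : ι → ℂ) (e : ι → ℤ),
      ∫ θ in (0 : ℝ)..(2 * Real.pi), ∑ i ∈ s, c i * Complex.exp (θ * Complex.I) ^ e i
        = 2 * Real.pi * ∑ i ∈ s with e i = 0, c i := by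
    intro ι s c e
    rw [intervalIntegral.integral_finsetSum, Finset.sum_filter, Finset.mul_sum]
    · refine Finset.sum_congr rfl fun i _ => ?_
      rw [intervalIntegral.integral_const_mul, integral_exp_I_zpow]
      split_ifs <;> ring
    · intro i _
      refine Continuous.intervalIntegrable ?_ _ _
      exact continuous_const.mul (Continuous.zpow₀ (by fun_prop) _
        fun θ => Or.inl (Complex.exp_ne_zero _))
  have h2 : (2 * Real.pi : ℂ) ≠ 0 := by
    exact_mod_cast Real.two_pi_pos.ne'
  apply mul_left_cancel₀ h2
  rw [← key s, ← key t]
  refine intervalIntegral.integral_congr fun θ _ => ?_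
  exact h _ (Complex.norm_exp_ofReal_mul_I θ)

/-! ### Zernike radial polynomials -/

open Polynomial in
/-- The polynomial `P_n^{0,m}(2u-1)` in `u`. -/
def radialPoly (m n : ℕ) : ℝ[X] :=
  ∑ j ∈ Finset.range (n + 1),
    C ((-1) ^ j * ((n + m).choose j * n.choose j : ℕ) : ℝ) * (X ^ (n - j) * (1 - X) ^ j)

theorem radialPoly_eval (m n : ℕ) (u : ℝ) :
    (radialPoly m n).eval u = ∑ j ∈ Finset.range (n + 1),
      (-1) ^ j * ((n + m).choose j * n.choose j : ℕ) * (u ^ (n - j) * (1 - u) ^ j) := by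
  simp [radialPoly, Polynomial.eval_finsetSum]

theorem radialPoly_eval_one (m n : ℕ) : (radialPoly m n).eval 1 = 1 := by
  rw [radialPoly_eval, Finset.sum_range_succ']
  simp

/-- This is the second ladder relation of the Jacobi polynomials. It raises `n` at the price of `m +
1`, so it identifies the two families by induction on `n` for all `m` at once. It is proved by
comparing coefficients of `u ^ (n + 1 - j) * (1 - u) ^ j`. -/
theorem radialPoly_eval_succ (m n : ℕ) (u : ℝ) :
    ((n : ℝ) + 1) * (radialPoly m (n + 1)).eval u
      = (2 * n + m + 2) * u * (radialPoly (m + 1) n).eval u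
        - (n + m + 1) * (radialPoly m n).eval u := by
  have e1 : (u : ℝ) * (radialPoly (m + 1) n).eval u = ∑ j ∈ Finset.range (n + 2),
      (-1) ^ j * ((n + m + 1).choose j * n.choose j : ℕ) * (u ^ (n + 1 - j) * (1 - u) ^ j) := by
    rw [radialPoly_eval, Finset.mul_sum, Finset.sum_range_succ _ (n + 1)]
    simp only [Nat.choose_succ_self, mul_zero, Nat.cast_zero, zero_mul, add_zero]
    refine Finset.sum_congr rfl fun j hj => ?_
    rw [Finset.mem_range] at hj
    rw [show n + 1 - j = n - j + 1 by omega, show n + (m + 1) = n + m + 1 by ring]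
    ring
  have e2 : (u : ℝ) * (radialPoly m n).eval u = ∑ j ∈ Finset.range (n + 2),
      (-1) ^ j * ((n + m).choose j * n.choose j : ℕ) * (u ^ (n + 1 - j) * (1 - u) ^ j) := by
    rw [radialPoly_eval, Finset.mul_sum, Finset.sum_range_succ _ (n + 1)]
    simp only [Nat.choose_succ_self, mul_zero, Nat.cast_zero, zero_mul, add_zero]
    refine Finset.sum_congr rfl fun j hj => ?_
    rw [Finset.mem_range] at hj
    rw [show n + 1 - j = n - j + 1 by omega]
    ring
  have e3 : (1 - u : ℝ) * (radialPoly m n).eval u = ∑ j ∈ Finset.range (n + 2),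
      if j = 0 then 0 else
      -(-1) ^ j * ((n + m).choose (j - 1) * n.choose (j - 1) : ℕ) *
        (u ^ (n + 1 - j) * (1 - u) ^ j) := by
    rw [radialPoly_eval, Finset.mul_sum, Finset.sum_range_succ' _ (n + 1)]
    simp only [Nat.add_eq_zero_iff, one_ne_zero, and_false, if_false, if_true, add_zero,
      Nat.add_sub_cancel, Nat.add_sub_add_right]
    refine Finset.sum_congr rfl fun j hj => ?_
    ring
  -- Multiplying by `u + (1 - u) = 1` raises the homogeneous degree in `u`, `1 - u` from `n` to `n +
  -- 1`, to match the other terms.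
  have e4 : (radialPoly m n).eval u
      = u * (radialPoly m n).eval u + (1 - u) * (radialPoly m n).eval u := by ring
  rw [mul_assoc, e1, e4, e2, e3, radialPoly_eval, mul_add, Finset.mul_sum, Finset.mul_sum,
    Finset.mul_sum, Finset.mul_sum, ← Finset.sum_add_distrib, ← Finset.sum_sub_distrib]
  refine Finset.sum_congr rfl fun j hj => ?_
  rw [show n + 1 + m = n + m + 1 by ring]
  cases j with
  | zero => simp; ring
  | succ j =>
    simp only [Nat.add_eq_zero_iff, one_ne_zero, and_false, if_false, Nat.add_sub_cancel]
    have hj : j ≤ n := by rw [Finset.mem_range] at hj; omega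
    have f1 : ((n + m + 1 : ℕ) : ℝ) * ((n + m).choose j : ℕ)
        = ((n + m + 1).choose (j + 1) : ℕ) * (j + 1 : ℕ) := by
      exact_mod_cast Nat.add_one_mul_choose_eq (n + m) j
    have f2 : ((n + 1 : ℕ) : ℝ) * (n.choose j : ℕ)
        = ((n + 1).choose (j + 1) : ℕ) * (j + 1 : ℕ) := by
      exact_mod_cast Nat.add_one_mul_choose_eq n j
    have f3 : ((n + m + 1).choose (j + 1) : ℝ) = (n + m).choose j + (n + m).choose (j + 1) := by
      exact_mod_cast Nat.choose_succ_succ (n + m) j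
    have f4 : ((n + 1).choose (j + 1) : ℝ) = n.choose j + n.choose (j + 1) := by
      exact_mod_cast Nat.choose_succ_succ n j
    push_cast at f1 f2 ⊢
    generalize (n.choose j : ℝ) = a at *
    generalize (n.choose (j + 1) : ℝ) = a' at *
    generalize ((n + m).choose j : ℝ) = b at *
    generalize ((n + m).choose (j + 1) : ℝ) = b' at *
    rw [f3] at f1
    rw [f4] at f2
    rw [f3, f4]
    have : ((n : ℝ) + 1) * ((b + b') * (a + a')) = (2 * n + m + 2) * ((b + b') * a')
        - (n + m + 1) * (b' * a') + (n + m + 1) * (b * a) := by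
      linear_combination (b + b') * f2 - (a + a') * f1
    linear_combination ((-1 : ℝ) ^ (j + 1) * (u ^ (n - j) * (1 - u) ^ (j + 1))) * this

theorem jacobiP_eq_radialPoly (m n : ℕ) (x : ℝ) :
    jacobiP 0 m n x = (radialPoly m n).eval ((1 + x) / 2) := by
  induction n generalizing m with
  | zero => simp [jacobiP, radialPoly_eval]
  | succ n ih =>
    have h := (jacobiP_ladder m n x).2
    rw [ih, ih] at h
    have h2 := radialPoly_eval_succ m n ((1 + x) / 2)
    have h0 : (n : ℝ) + 1 ≠ 0 := by positivity
    apply mul_left_cancel₀ h0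
    rw [h2]
    linear_combination -h

/-! ### Zernike polynomials as matrix coefficients, and the addition formula -/

theorem zernikeQ_eq (m n : ℕ) (z : ℂ) :
    zernikeQ 0 m n z = z ^ m * ((radialPoly m n).eval (‖z‖ ^ 2) : ℝ) := by
  rw [zernikeQ_natCast, jacobiP_eq_radialPoly]
  congr 4
  ring

/-- A Zernike polynomial is a diagonal matrix coefficient of a symmetric power. -/
theorem symPowEntry_unitary (m n : ℕ) (a b : ℂ) (h : ‖a‖ ^ 2 + ‖b‖ ^ 2 = 1) :
    symPowEntry (2 * n + m) (n + m) (n + m) a b (-(starRingEnd ℂ) b) ((starRingEnd ℂ) a)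
      = zernikeQ 0 m n a := by
  rw [symPowEntry_diag, zernikeQ_eq, radialPoly_eval]
  push_cast
  rw [Finset.mul_sum]
  refine Finset.sum_congr rfl fun j hj => ?_
  rw [Finset.mem_range] at hj
  -- Unitarity turns the off-diagonal product into `-(1 - u)` with `u = ‖a‖ ^ 2`, so the entry
  -- depends on `a` alone.
  have hb : b * -(starRingEnd ℂ) b = -1 * (1 - (‖a‖ : ℂ) ^ 2) := by
    have : (‖a‖ : ℂ) ^ 2 + (‖b‖ : ℂ) ^ 2 = 1 := by exact_mod_cast h
    linear_combination -Complex.mul_conj' b - this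
  rw [hb, mul_pow, ← Complex.mul_conj' a, show n + m - j = m + (n - j) by omega, pow_add, mul_pow]
  ring

/-- The entries of the `(n+m)`-th column of the symmetric power of a rotation. -/
def rotEntry (m n k : ℕ) (c s : ℝ) : ℝ := symPowEntry (2 * n + m) k (n + m) c s (-s) c

/-- The positive weights in the addition formula. -/
def rotWeight (m n k : ℕ) : ℝ := ((2 * n + m).choose k : ℝ) / (2 * n + m).choose (n + m)

theorem rotWeight_nonneg (m n k : ℕ) : 0 ≤ rotWeight m n k := by
  unfold rotWeight; positivity

theorem continuous_rotEntry (m n k : ℕ) {f g : ℝ → ℝ} (hf : Continuous f) (hg : Continuous g) :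
    Continuous fun x => rotEntry m n k (f x) (g x) := by
  unfold rotEntry
  simp only [symPowEntry_eq_sum]
  fun_prop

/-- The addition formula for Zernike polynomials. -/
theorem zernikeQ_add_formula (m n : ℕ) {c s c' s' : ℝ} (h : c ^ 2 + s ^ 2 = 1)
    (h' : c' ^ 2 + s' ^ 2 = 1) {w : ℂ} (hw : ‖w‖ = 1) :
    zernikeQ 0 m n ((c * c' : ℝ) * w + (s * s' : ℝ) * w⁻¹)
      = ∑ k ∈ Finset.range (2 * n + m + 1),
        ((rotWeight m n k * (rotEntry m n k c s * rotEntry m n k c' s') : ℝ) : ℂ)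
          * w ^ (2 * (k : ℤ) - (2 * n + m : ℕ)) := by
  have hw0 : w ≠ 0 := by rintro rfl; simp at hw
  have hi : (starRingEnd ℂ) w = w⁻¹ := (Complex.inv_eq_conj hw).symm
  have hj : (starRingEnd ℂ) w⁻¹ = w := by rw [← hi, Complex.conj_conj]
  have hww : w * w⁻¹ = 1 := mul_inv_cancel₀ hw0
  have hle : n + m ≤ 2 * n + m := by omega
  -- The unitary matrix with the required corner is factored as rotation, `diag(w, w⁻¹)`, rotation.
  have hmul := symPowEntry_mul hle (n + m) (c : ℂ) (-s : ℝ) (s : ℝ) c c' s' (-s' : ℝ) c' w w⁻¹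
  have hunit := symPowEntry_unitary m n ((c * c' : ℝ) * w + (s * s' : ℝ) * w⁻¹)
    ((c * s' : ℝ) * w + (-(s * c') : ℝ) * w⁻¹) (by
      rw [← Complex.ofReal_inj]
      push_cast
      rw [← Complex.mul_conj', ← Complex.mul_conj']
      simp only [map_add, map_mul, map_neg, Complex.conj_ofReal, hi, hj]
      have h2 : (c : ℂ) ^ 2 + (s : ℂ) ^ 2 = 1 := by exact_mod_cast h
      have h2' : (c' : ℂ) ^ 2 + (s' : ℂ) ^ 2 = 1 := by exact_mod_cast h'
      linear_combination ((c : ℂ) ^ 2 + (s : ℂ) ^ 2) * ((c' : ℂ) ^ 2 + (s' : ℂ) ^ 2) * hww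
        + ((c' : ℂ) ^ 2 + (s' : ℂ) ^ 2) * h2 + h2')
  rw [← hunit]
  refine Eq.trans ?_ (hmul.trans ?_)
  · simp only [map_add, map_mul, Complex.conj_ofReal, hi, hj]
    push_cast
    congr 1 <;> ring
  · refine Finset.sum_congr rfl fun k hk => ?_
    rw [Finset.mem_range] at hk
    have hk' : k ≤ 2 * n + m := by omega
    have hC : ((2 * n + m).choose (n + m) : ℝ) ≠ 0 := by
      exact_mod_cast (Nat.choose_pos hle).ne'
    -- Transposition converts the row entry of the left rotation into a positive multiple of the
    -- same column entry that the right rotation contributes. This symmetry is what later produces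
    -- squares.
    have e1 : symPowEntry (2 * n + m) (n + m) k (c : ℂ) (-s : ℝ) (s : ℝ) c
        = ((rotWeight m n k * rotEntry m n k c s : ℝ) : ℂ) := by
      rw [← Complex.ofRealHom_eq_coe, ← Complex.ofRealHom_eq_coe, ← Complex.ofRealHom_eq_coe,
        symPowEntry_map, Complex.ofRealHom_eq_coe, Complex.ofReal_inj]
      apply mul_left_cancel₀ hC
      rw [choose_mul_symPowEntry hle hk', rotWeight, rotEntry]
      field_simp
    have e2 : symPowEntry (2 * n + m) k (n + m) (c' : ℂ) s' (-s' : ℝ) c'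
        = (rotEntry m n k c' s' : ℂ) := by
      rw [← Complex.ofRealHom_eq_coe, ← Complex.ofRealHom_eq_coe, ← Complex.ofRealHom_eq_coe,
        symPowEntry_map, Complex.ofRealHom_eq_coe, rotEntry]
    have e3 : w ^ k * w⁻¹ ^ (2 * n + m - k) = w ^ (2 * (k : ℤ) - (2 * n + m : ℕ)) := by
      rw [inv_pow, ← zpow_natCast, ← zpow_natCast, ← zpow_neg, ← zpow_add₀ hw0, Nat.cast_sub hk']
      congr 1
      ring
    rw [e1, e2, e3]
    push_cast
    ring

/-- The addition formula with both rotations equal and `w = 1` evaluates the polynomial at `1`, and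
so writes `1` as a sum of nonnegative terms. The term `k = n + m` has weight one and equals `𝒬(‖z‖)
^ 2`. -/
theorem norm_zernikeQ_le_one (m n : ℕ) {z : ℂ} (hz : ‖z‖ ≤ 1) : ‖zernikeQ 0 m n z‖ ≤ 1 := by
  have hz0 := norm_nonneg z
  set s := Real.sqrt (1 - ‖z‖ ^ 2) with hs
  have hcs : ‖z‖ ^ 2 + s ^ 2 = 1 := by
    rw [hs, Real.sq_sqrt (by nlinarith)]; ring
  have h1 := zernikeQ_add_formula m n hcs hcs (w := 1) (by simp)
  have e1 : ((‖z‖ * ‖z‖ : ℝ) : ℂ) * 1 + (s * s : ℝ) * 1⁻¹ = 1 := by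
    rw [inv_one, mul_one, mul_one, ← Complex.ofReal_add, ← sq, ← sq, hcs, Complex.ofReal_one]
  rw [e1, zernikeQ_eq] at h1
  simp only [norm_one, one_pow, radialPoly_eval_one, one_zpow, mul_one, Complex.ofReal_one] at h1
  have h2 : (1 : ℝ) = ∑ k ∈ Finset.range (2 * n + m + 1),
      rotWeight m n k * (rotEntry m n k ‖z‖ s * rotEntry m n k ‖z‖ s) := by
    rw [← Complex.ofReal_inj]
    push_cast at h1 ⊢
    exact h1
  have h3 : rotWeight m n (n + m) * (rotEntry m n (n + m) ‖z‖ s * rotEntry m n (n + m) ‖z‖ s)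
      ≤ 1 := by
    rw [h2]
    exact Finset.single_le_sum (f := fun k => rotWeight m n k *
      (rotEntry m n k ‖z‖ s * rotEntry m n k ‖z‖ s))
      (fun k _ => mul_nonneg (rotWeight_nonneg _ _ _) (mul_self_nonneg _))
      (Finset.mem_range.2 (by omega))
  have hw : rotWeight m n (n + m) = 1 := by
    rw [rotWeight, div_self]
    exact_mod_cast (Nat.choose_pos (by omega)).ne'
  rw [hw, one_mul, ← sq, sq_le_one_iff_abs_le_one] at h3
  have h4 : (rotEntry m n (n + m) ‖z‖ s : ℂ) = zernikeQ 0 m n (‖z‖ : ℂ) := by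
    rw [← symPowEntry_unitary m n (‖z‖ : ℂ) (s : ℂ) (by simpa using hcs), rotEntry,
      ← Complex.ofRealHom_eq_coe, ← symPowEntry_map]
    simp
  have h5 : ‖zernikeQ 0 m n z‖ = ‖zernikeQ 0 m n (‖z‖ : ℂ)‖ := by
    simp [zernikeQ_eq]
  rw [h5, ← h4, Complex.norm_real]
  exact h3

/-! ### Averaging over the circle and positivity of triple products -/

/-- The average of a polynomial in `|A w + B w̄|²` over the unit circle. -/
theorem sum_coeff_eq_of_forall_unit (F : Polynomial ℝ) (A B : ℝ) {κ : Type} (t : Finset κ)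
    (c' : κ → ℝ) (e' : κ → ℤ)
    (h : ∀ w : ℂ, ‖w‖ = 1 → ((F.eval (‖(A : ℂ) * w + B * w⁻¹‖ ^ 2) : ℝ) : ℂ)
      = ∑ i ∈ t, (c' i : ℂ) * w ^ e' i) :
    ∑ l ∈ Finset.range (F.natDegree + 1), F.coeff l * ∑ j ∈ Finset.range (l + 1),
      (l.choose j : ℝ) ^ 2 * ((A ^ 2) ^ j * (B ^ 2) ^ (l - j)) = ∑ i ∈ t with e' i = 0, c' i := by
  have key := sum_filter_eq_of_forall_unit
    ((Finset.range (F.natDegree + 1)).sigma fun l => Finset.range (l + 1) ×ˢ Finset.range (l + 1)) t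
    (fun x => ((F.coeff x.1 * ((x.1.choose x.2.1 * A ^ x.2.1 * B ^ (x.1 - x.2.1)) *
      (x.1.choose x.2.2 * A ^ x.2.2 * B ^ (x.1 - x.2.2))) : ℝ) : ℂ))
    (fun i => (c' i : ℂ)) (fun x => 2 * (x.2.1 : ℤ) - 2 * (x.2.2 : ℤ)) e' (by
      intro w hw
      have hw0 : w ≠ 0 := by rintro rfl; simp at hw
      have hi : (starRingEnd ℂ) w = w⁻¹ := (Complex.inv_eq_conj hw).symm
      have hj : (starRingEnd ℂ) w⁻¹ = w := by rw [← hi, Complex.conj_conj]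
      rw [← h w hw, Polynomial.eval_eq_sum_range, Finset.sum_sigma]
      push_cast
      refine Finset.sum_congr rfl fun l _ => ?_
      rw [← Complex.mul_conj']
      simp only [map_add, map_mul, Complex.conj_ofReal, hi, hj]
      rw [mul_pow, add_comm ((A : ℂ) * w⁻¹), add_pow, add_comm ((B : ℂ) * w), add_pow,
        Finset.sum_mul_sum, Finset.mul_sum, Finset.sum_product]
      refine Finset.sum_congr rfl fun j hj => ?_
      rw [Finset.mul_sum]
      refine Finset.sum_congr rfl fun j' hj' => ?_
      rw [Finset.mem_range] at hj hj'
      have e : w ^ (2 * (j : ℤ) - 2 * (j' : ℤ))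
          = w ^ j * w⁻¹ ^ (l - j) * (w⁻¹ ^ j' * w ^ (l - j')) := by
        rw [inv_pow, inv_pow, ← zpow_natCast, ← zpow_natCast, ← zpow_natCast, ← zpow_natCast,
          ← zpow_neg, ← zpow_neg, ← zpow_add₀ hw0, ← zpow_add₀ hw0, ← zpow_add₀ hw0,
          Nat.cast_sub (by omega), Nat.cast_sub (by omega)]
        congr 1
        ring
      simp only [e, mul_pow]
      ring)
  rw [← Complex.ofReal_inj]
  push_cast at key ⊢
  rw [← key, Finset.sum_filter, Finset.sum_sigma]
  refine Finset.sum_congr rfl fun l _ => ?_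
  rw [Finset.sum_product, Finset.mul_sum]
  refine Finset.sum_congr rfl fun j hj => ?_
  -- The exponent `2 j - 2 j'` of `w` vanishes only on the diagonal, whence the squared binomials.
  rw [Finset.sum_eq_single_of_mem j hj]
  · simp only [sub_self, if_true]
    ring
  · intro j' _ hne
    rw [if_neg]
    intro h0
    dsimp only at h0
    exact hne (by omega)

/-- By the Beta integral, one factor `l.choose j` cancels and leaves `1 / (l + 1)`. The binomial
theorem in `v`, `1 - v` then sums the rest to one, so the `u`-integral of the circle average does
not depend on `v`. -/
theorem integral_sum_choose_sq (F : Polynomial ℝ) (v : ℝ) :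
    ∫ u in (0 : ℝ)..1, ∑ l ∈ Finset.range (F.natDegree + 1), F.coeff l *
      ∑ j ∈ Finset.range (l + 1),
        (l.choose j : ℝ) ^ 2 * ((u * v) ^ j * ((1 - u) * (1 - v)) ^ (l - j))
    = ∫ u in (0 : ℝ)..1, F.eval u := by
  simp_rw [Polynomial.eval_eq_sum_range]
  rw [intervalIntegral.integral_finsetSum fun l _ => Continuous.intervalIntegrable (by fun_prop) _ _,
    intervalIntegral.integral_finsetSum fun l _ => Continuous.intervalIntegrable (by fun_prop) _ _]
  refine Finset.sum_congr rfl fun l _ => ?_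
  rw [intervalIntegral.integral_const_mul, intervalIntegral.integral_const_mul,
    intervalIntegral.integral_finsetSum fun l _ => Continuous.intervalIntegrable (by fun_prop) _ _]
  congr 1
  have hv : ∑ j ∈ Finset.range (l + 1), v ^ j * (1 - v) ^ (l - j) * (l.choose j : ℝ) = 1 := by
    rw [← add_pow]; simp
  have hl : ∫ u in (0 : ℝ)..1, u ^ l
      = (∑ j ∈ Finset.range (l + 1), v ^ j * (1 - v) ^ (l - j) * (l.choose j : ℝ)) / (l + 1) := by
    rw [hv, integral_pow, one_pow, zero_pow (Nat.succ_ne_zero l), sub_zero]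
  rw [hl, Finset.sum_div]
  refine Finset.sum_congr rfl fun j hj => ?_
  rw [Finset.mem_range] at hj
  have e : ∀ u : ℝ, (l.choose j : ℝ) ^ 2 * ((u * v) ^ j * ((1 - u) * (1 - v)) ^ (l - j))
      = (l.choose j : ℝ) ^ 2 * (v ^ j * (1 - v) ^ (l - j)) * (u ^ j * (1 - u) ^ (l - j)) := by
    intro u
    rw [mul_pow, mul_pow]; ring
  rw [intervalIntegral.integral_congr fun u _ => e u, intervalIntegral.integral_const_mul,
    integral_pow_mul_one_sub_pow,
    show j + (l - j) + 1 = l + 1 by omega, Nat.factorial_succ]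
  have hc : (l.choose j : ℝ) * j.factorial * (l - j).factorial = l.factorial := by
    exact_mod_cast Nat.choose_mul_factorial_mul_factorial (show j ≤ l by omega)
  have hl : (l.factorial : ℝ) ≠ 0 := by positivity
  have hl1 : (l : ℝ) + 1 ≠ 0 := by positivity
  push_cast
  rw [← hc] at hl ⊢
  field_simp

/-- Triple products of Zernike polynomials have nonnegative integral over the disk. -/
theorem integral_radialPoly_mul_mul_nonneg (m₁ m₂ n₁ n₂ n₃ : ℕ) :
    0 ≤ ∫ u in (0 : ℝ)..1, (Polynomial.X ^ (m₁ + m₂) * radialPoly m₁ n₁ * radialPoly m₂ n₂ *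
      radialPoly (m₁ + m₂) n₃ : Polynomial ℝ).eval u := by
  set F := (Polynomial.X ^ (m₁ + m₂) * radialPoly m₁ n₁ * radialPoly m₂ n₂ *
      radialPoly (m₁ + m₂) n₃ : Polynomial ℝ) with hF
  -- The wave numbers `m₁ + m₂ - (m₁ + m₂)` cancel, so the triple product is a function of `‖a‖ ^
  -- 2`.
  have hFQ : ∀ a : ℂ, ((F.eval (‖a‖ ^ 2) : ℝ) : ℂ)
      = zernikeQ 0 m₁ n₁ a * zernikeQ 0 m₂ n₂ a *
        (starRingEnd ℂ) (zernikeQ 0 ((m₁ + m₂ : ℕ) : ℤ) n₃ a) := by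
    intro a
    simp only [zernikeQ_eq, hF, Polynomial.eval_mul, Polynomial.eval_pow, Polynomial.eval_X,
      map_mul, map_pow, Complex.conj_ofReal]
    push_cast
    rw [← Complex.mul_conj']
    ring
  clear_value F
  set S := Finset.range (2 * n₁ + m₁ + 1) ×ˢ Finset.range (2 * n₂ + m₂ + 1) ×ˢ
    Finset.range (2 * n₃ + (m₁ + m₂) + 1) with hS
  let e : ℕ × ℕ × ℕ → ℤ := fun k => (2 * (k.1 : ℤ) - (2 * n₁ + m₁ : ℕ))
    + (2 * (k.2.1 : ℤ) - (2 * n₂ + m₂ : ℕ)) - (2 * (k.2.2 : ℤ) - (2 * n₃ + (m₁ + m₂) : ℕ))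
  let κ : ℕ × ℕ × ℕ → ℝ := fun k => rotWeight m₁ n₁ k.1 * rotWeight m₂ n₂ k.2.1 *
    rotWeight (m₁ + m₂) n₃ k.2.2
  let H : ℕ × ℕ × ℕ → ℝ → ℝ := fun k u =>
    rotEntry m₁ n₁ k.1 (Real.sqrt u) (Real.sqrt (1 - u)) *
    rotEntry m₂ n₂ k.2.1 (Real.sqrt u) (Real.sqrt (1 - u)) *
    rotEntry (m₁ + m₂) n₃ k.2.2 (Real.sqrt u) (Real.sqrt (1 - u))
  have hκ : ∀ k, 0 ≤ κ k := fun k =>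
    mul_nonneg (mul_nonneg (rotWeight_nonneg _ _ _) (rotWeight_nonneg _ _ _))
      (rotWeight_nonneg _ _ _)
  have hHc : ∀ k, Continuous (H k) := by
    intro k
    have h1 : Continuous fun u : ℝ => Real.sqrt u := by fun_prop
    have h2 : Continuous fun u : ℝ => Real.sqrt (1 - u) := by fun_prop
    exact ((continuous_rotEntry _ _ _ h1 h2).mul (continuous_rotEntry _ _ _ h1 h2)).mul
      (continuous_rotEntry _ _ _ h1 h2)
  -- The circle average at `a = √(u v) w + √((1-u)(1-v)) w⁻¹`, computed in two ways: from the
  -- expansion of `F`, and from the three addition formulas. The latter gives a kernel with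
  -- separated variables and positive weights.
  have main : ∀ u ∈ Set.Icc (0 : ℝ) 1, ∀ v ∈ Set.Icc (0 : ℝ) 1,
      ∑ l ∈ Finset.range (F.natDegree + 1), F.coeff l * ∑ j ∈ Finset.range (l + 1),
        (l.choose j : ℝ) ^ 2 * ((u * v) ^ j * ((1 - u) * (1 - v)) ^ (l - j))
      = ∑ k ∈ S with e k = 0, κ k * (H k u * H k v) := by
    intro u hu v hv
    have hcs : ∀ u ∈ Set.Icc (0 : ℝ) 1, Real.sqrt u ^ 2 + Real.sqrt (1 - u) ^ 2 = 1 := by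
      intro u hu
      rw [Real.sq_sqrt hu.1, Real.sq_sqrt (by linarith [hu.2])]; ring
    have hA : (Real.sqrt u * Real.sqrt v) ^ 2 = u * v := by
      rw [mul_pow, Real.sq_sqrt hu.1, Real.sq_sqrt hv.1]
    have hB : (Real.sqrt (1 - u) * Real.sqrt (1 - v)) ^ 2 = (1 - u) * (1 - v) := by
      rw [mul_pow, Real.sq_sqrt (sub_nonneg.2 hu.2), Real.sq_sqrt (sub_nonneg.2 hv.2)]
    rw [← sum_coeff_eq_of_forall_unit F (Real.sqrt u * Real.sqrt v)
      (Real.sqrt (1 - u) * Real.sqrt (1 - v)) S (fun k => κ k * (H k u * H k v)) e, hA, hB]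
    · intro w hw
      have hw0 : w ≠ 0 := by rintro rfl; simp at hw
      have hi : (starRingEnd ℂ) w = w⁻¹ := (Complex.inv_eq_conj hw).symm
      rw [hFQ, zernikeQ_add_formula _ _ (hcs u hu) (hcs v hv) hw,
        zernikeQ_add_formula _ _ (hcs u hu) (hcs v hv) hw,
        zernikeQ_add_formula _ _ (hcs u hu) (hcs v hv) hw, map_sum, mul_assoc,
        Finset.sum_mul_sum, Finset.sum_mul_sum, Finset.sum_product]
      refine Finset.sum_congr rfl fun k₁ _ => ?_
      rw [Finset.sum_product]
      refine Finset.sum_congr rfl fun k₂ _ => ?_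
      rw [Finset.mul_sum]
      refine Finset.sum_congr rfl fun k₃ _ => ?_
      have he : w ^ e (k₁, k₂, k₃) = w ^ (2 * (k₁ : ℤ) - (2 * n₁ + m₁ : ℕ)) *
          (w ^ (2 * (k₂ : ℤ) - (2 * n₂ + m₂ : ℕ)) *
            (w⁻¹) ^ (2 * (k₃ : ℤ) - (2 * n₃ + (m₁ + m₂) : ℕ))) := by
        rw [inv_zpow, ← zpow_neg, ← zpow_add₀ hw0, ← zpow_add₀ hw0]
        congr 1
        simp only [e]
        ring
      rw [he, map_mul, map_zpow₀, hi, Complex.conj_ofReal]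
      simp only [κ, H]
      push_cast
      ring
  have step : ∀ v ∈ Set.Icc (0 : ℝ) 1, ∫ u in (0 : ℝ)..1, F.eval u
      = ∑ k ∈ S with e k = 0, κ k * ((∫ u in (0 : ℝ)..1, H k u) * H k v) := by
    intro v hv
    rw [← integral_sum_choose_sq F v]
    rw [intervalIntegral.integral_congr (g := fun u => ∑ k ∈ S with e k = 0, κ k * (H k u * H k v))
      (fun u hu => main u (by rwa [Set.uIcc_of_le zero_le_one] at hu) v hv),
      intervalIntegral.integral_finsetSum]
    · refine Finset.sum_congr rfl fun k _ => ?_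
      rw [intervalIntegral.integral_const_mul, intervalIntegral.integral_mul_const]
    · intro k _
      exact (continuous_const.mul ((hHc k).mul continuous_const)).intervalIntegrable _ _
  -- The left side is independent of `v`; integrating over `v` as well turns each term into a
  -- square.
  have fin : ∫ u in (0 : ℝ)..1, F.eval u
      = ∑ k ∈ S with e k = 0, κ k * ((∫ u in (0 : ℝ)..1, H k u) * ∫ u in (0 : ℝ)..1, H k u) := by
    have h1 : ∫ u in (0 : ℝ)..1, F.eval u
        = ∫ v in (0 : ℝ)..1, ∫ u in (0 : ℝ)..1, F.eval u := by simp
    rw [h1, intervalIntegral.integral_congr (g := fun v => ∑ k ∈ S with e k = 0,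
        κ k * ((∫ u in (0 : ℝ)..1, H k u) * H k v))
      (fun v hv => step v (by rwa [Set.uIcc_of_le zero_le_one] at hv)),
      intervalIntegral.integral_finsetSum]
    · refine Finset.sum_congr rfl fun k _ => ?_
      rw [intervalIntegral.integral_const_mul, intervalIntegral.integral_const_mul]
    · intro k _
      exact (continuous_const.mul (continuous_const.mul (hHc k))).intervalIntegrable _ _
  rw [fin]
  exact Finset.sum_nonneg fun k _ => mul_nonneg (hκ k) (mul_self_nonneg _)

/-! ### Orthogonality of the radial polynomials -/

/-- The integral of a polynomial over `[0, 1]`. -/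
def polyIntegral : Polynomial ℝ →ₗ[ℝ] ℝ where
  toFun q := ∫ u in (0 : ℝ)..1, q.eval u
  map_add' p q := by
    simp only [Polynomial.eval_add]
    exact intervalIntegral.integral_add (p.continuous.intervalIntegrable _ _)
      (q.continuous.intervalIntegrable _ _)
  map_smul' c p := by
    simp only [Polynomial.eval_smul, smul_eq_mul, RingHom.id_apply]
    exact intervalIntegral.integral_const_mul _ _

open Polynomial in
theorem polyIntegral_C_mul (c : ℝ) (p : ℝ[X]) : polyIntegral (C c * p) = c * polyIntegral p := by
  rw [← smul_eq_C_mul, map_smul, smul_eq_mul]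

open Polynomial in
theorem radialPoly_ladder (m n : ℕ) :
    C (2 * (n : ℝ) + m + 1) * radialPoly m n
      = C ((n : ℝ) + m + 1) * radialPoly (m + 1) n + C (n : ℝ) * radialPoly (m + 1) (n - 1) := by
  refine Polynomial.funext fun u => ?_
  have h := (jacobiP_ladder m n (2 * u - 1)).1
  simp only [jacobiP_eq_radialPoly] at h
  rw [show (1 + (2 * u - 1)) / 2 = u by ring] at h
  simpa only [eval_add, eval_mul, eval_C] using h

open Polynomial in
theorem radialPoly_succ (m n : ℕ) :
    C ((n : ℝ) + 1) * radialPoly m (n + 1)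
      = C (2 * (n : ℝ) + m + 2) * (X * radialPoly (m + 1) n) - C ((n : ℝ) + m + 1) * radialPoly m n
      := by
  refine Polynomial.funext fun u => ?_
  simp only [eval_sub, eval_mul, eval_C, eval_X]
  rw [radialPoly_eval_succ]
  ring

/-- The degree is exactly `n`, so the radial polynomials of fixed `m` form a triangular basis. -/
theorem radialPoly_coeff (m n : ℕ) :
    (∀ k, n < k → (radialPoly m n).coeff k = 0) ∧ 0 < (radialPoly m n).coeff n := by
  induction n generalizing m with
  | zero =>
    have : radialPoly m 0 = 1 := by simp [radialPoly]
    rw [this]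
    refine ⟨fun k hk => ?_, by simp⟩
    rw [Polynomial.coeff_one, if_neg (by omega)]
  | succ n ih =>
    have h : ∀ k, ((n : ℝ) + 1) * (radialPoly m (n + 1)).coeff (k + 1)
        = (2 * n + m + 2) * (radialPoly (m + 1) n).coeff k
          - (n + m + 1) * (radialPoly m n).coeff (k + 1) := fun k => by
      have := congrArg (fun p => Polynomial.coeff p (k + 1)) (radialPoly_succ m n)
      simpa only [Polynomial.coeff_sub, Polynomial.coeff_C_mul, Polynomial.coeff_X_mul] using this
    have hn : (0 : ℝ) < n + 1 := by positivity
    constructor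
    · intro k hk
      obtain ⟨k, rfl⟩ : ∃ k', k = k' + 1 := ⟨k - 1, by omega⟩
      have := h k
      rw [(ih (m + 1)).1 k (by omega), (ih m).1 (k + 1) (by omega)] at this
      simpa [hn.ne'] using this
    · have := h n
      rw [(ih m).1 (n + 1) (by omega), mul_zero, sub_zero] at this
      have h2 : 0 < ((n : ℝ) + 1) * (radialPoly m (n + 1)).coeff (n + 1) := by
        rw [this]
        exact mul_pos (by positivity) (ih (m + 1)).2
      exact (mul_pos_iff_of_pos_left hn).1 h2

/-- The Beta integral cancels `(n + m).choose j`, leaving the alternating sum of `n.choose j`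
divided by `m + n + 1`. -/
theorem polyIntegral_radialPoly (m n : ℕ) (hn : n ≠ 0) :
    polyIntegral (Polynomial.X ^ m * radialPoly m n) = 0 := by
  have h1 : (∑ j ∈ Finset.range (n + 1), ((-1) ^ j * (n.choose j : ℝ))) = 0 := by
    have := Int.alternating_sum_range_choose_of_ne hn
    exact_mod_cast this
  have hc : ((m + n + 1 : ℕ) : ℝ) ≠ 0 := by positivity
  rw [radialPoly, Finset.mul_sum, map_sum, ← zero_div ((m + n + 1 : ℕ) : ℝ), ← h1,
    Finset.sum_div]
  refine Finset.sum_congr rfl fun j hj => ?_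
  rw [Finset.mem_range] at hj
  have e : ∀ c : ℝ, Polynomial.X ^ m * (Polynomial.C c *
      (Polynomial.X ^ (n - j) * (1 - Polynomial.X) ^ j))
      = Polynomial.C c * (Polynomial.X ^ (m + (n - j)) * (1 - Polynomial.X) ^ j) := fun c => by
    rw [pow_add]; ring
  have hI : polyIntegral (Polynomial.X ^ (m + (n - j)) * (1 - Polynomial.X) ^ j)
      = ((m + (n - j)).factorial * j.factorial : ℝ) / (m + n + 1).factorial := by
    have := integral_pow_mul_one_sub_pow (m + (n - j)) j
    rw [show m + (n - j) + j + 1 = m + n + 1 by omega] at this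
    rw [← this]
    simp [polyIntegral]
  rw [e, polyIntegral_C_mul, hI, Nat.factorial_succ]
  have hf : ((n + m).choose j : ℝ) * j.factorial * (m + (n - j)).factorial
      = (m + n).factorial := by
    have := Nat.choose_mul_factorial_mul_factorial (show j ≤ n + m by omega)
    rw [show n + m - j = m + (n - j) by omega, show (n + m).factorial = (m + n).factorial by
      rw [add_comm]] at this
    exact_mod_cast this
  have hfp : ((m + n).factorial : ℝ) ≠ 0 := by positivity
  push_cast at hc ⊢
  have hch : ((n + m).choose j : ℝ) ≠ 0 := by
    exact_mod_cast (Nat.choose_pos (show j ≤ n + m by omega)).ne'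
  rw [← hf] at hfp ⊢
  field_simp

/-- The first ladder relation moves one power of the variable from the test monomial into the
weight: `(m, k + 1)` becomes `(m + 1, k)`, with degrees `n` and `n - 1`, both still above `k`. -/
theorem polyIntegral_pow_mul_radialPoly (k m n : ℕ) (h : k < n) :
    polyIntegral (Polynomial.X ^ (m + k) * radialPoly m n) = 0 := by
  induction k generalizing m n with
  | zero => exact polyIntegral_radialPoly m n (by omega)
  | succ k ih =>
    have h1 := ih (m + 1) n (by omega)
    have h2 := ih (m + 1) (n - 1) (by omega)
    have hc : 2 * (n : ℝ) + m + 1 ≠ 0 := by positivity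
    have h3 : polyIntegral (Polynomial.C (2 * (n : ℝ) + m + 1) *
        (Polynomial.X ^ (m + (k + 1)) * radialPoly m n)) = 0 := by
      have : Polynomial.C (2 * (n : ℝ) + m + 1) *
        (Polynomial.X ^ (m + (k + 1)) * radialPoly m n)
        = Polynomial.C ((n : ℝ) + m + 1) * (Polynomial.X ^ (m + 1 + k) * radialPoly (m + 1) n)
          + Polynomial.C (n : ℝ) * (Polynomial.X ^ (m + 1 + k) * radialPoly (m + 1) (n - 1)) := by
        rw [show m + (k + 1) = m + 1 + k by ring]
        linear_combination (Polynomial.X ^ (m + 1 + k)) * radialPoly_ladder m n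
      rw [this, map_add, polyIntegral_C_mul, polyIntegral_C_mul, h1, h2]
      simp
    rw [polyIntegral_C_mul] at h3
    exact (mul_eq_zero.1 h3).resolve_left hc

/-- The radial polynomials are orthogonal to all polynomials of lower degree. -/
theorem polyIntegral_mul_radialPoly (m n : ℕ) (q : Polynomial ℝ) (h : ∀ k, n ≤ k → q.coeff k = 0) :
    polyIntegral (Polynomial.X ^ m * q * radialPoly m n) = 0 := by
  rw [q.as_sum_range_C_mul_X_pow, Finset.mul_sum, Finset.sum_mul, map_sum]
  refine Finset.sum_eq_zero fun k _ => ?_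
  have e : ∀ c : ℝ, Polynomial.X ^ m * (Polynomial.C c * Polynomial.X ^ k) * radialPoly m n
      = Polynomial.C c * (Polynomial.X ^ (m + k) * radialPoly m n) := fun c => by
    rw [pow_add]; ring
  rw [e, polyIntegral_C_mul]
  by_cases hk : k < n
  · rw [polyIntegral_pow_mul_radialPoly k m n hk, mul_zero]
  · rw [h k (by omega), zero_mul]

theorem polyIntegral_radialPoly_mul_radialPoly (m n k : ℕ) (h : n ≠ k) :
    polyIntegral (Polynomial.X ^ m * radialPoly m n * radialPoly m k) = 0 := by
  rcases lt_or_gt_of_ne h with h | h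
  · exact polyIntegral_mul_radialPoly m k _ fun j hj => (radialPoly_coeff m n).1 j (by omega)
  · rw [mul_right_comm]
    exact polyIntegral_mul_radialPoly m n _ fun j hj => (radialPoly_coeff m k).1 j (by omega)

theorem polyIntegral_radialPoly_sq_pos (m n : ℕ) :
    0 < polyIntegral (Polynomial.X ^ m * radialPoly m n * radialPoly m n) := by
  refine intervalIntegral.integral_pos one_pos (Polynomial.continuous _).continuousOn
    (fun u hu => ?_) ⟨1, by simp, ?_⟩
  · simp only [Polynomial.eval_mul, Polynomial.eval_pow, Polynomial.eval_X, mul_assoc]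
    exact mul_nonneg (pow_nonneg hu.1.le _) (mul_self_nonneg _)
  · simp [radialPoly_eval_one]

theorem exists_eq_sum_radialPoly (m N : ℕ) (q : Polynomial ℝ) (h : ∀ k, N ≤ k → q.coeff k = 0) :
    ∃ c : ℕ → ℝ, q = ∑ n ∈ Finset.range N, Polynomial.C (c n) * radialPoly m n := by
  induction N generalizing q with
  | zero =>
    refine ⟨0, ?_⟩
    ext k
    simp [h k (by omega)]
  | succ N ih =>
    obtain ⟨h1, h2⟩ := radialPoly_coeff m N
    set t := q.coeff N / (radialPoly m N).coeff N with ht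
    obtain ⟨c, hc⟩ := ih (q - Polynomial.C t * radialPoly m N) (by
      intro k hk
      rw [Polynomial.coeff_sub, Polynomial.coeff_C_mul]
      rcases hk.lt_or_eq with hk | rfl
      · rw [h1 k hk, h k hk]; simp
      · rw [ht, div_mul_cancel₀ _ h2.ne', sub_self])
    refine ⟨fun n => if n = N then t else c n, ?_⟩
    rw [Finset.sum_range_succ]
    dsimp only
    rw [if_pos rfl, ← sub_eq_iff_eq_add, hc]
    refine Finset.sum_congr rfl fun n hn => ?_
    rw [if_neg (Finset.mem_range.1 hn).ne]

/-! ### Linearization of products and uniqueness of coefficients -/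

/-- The linearization of products of Zernike polynomials: the coefficients are nonnegative and sum
to one. -/
theorem exists_linearization (m₁ m₂ n₁ n₂ : ℕ) :
    ∃ c : ℕ → ℝ, (∀ n, 0 ≤ c n) ∧ ∑ n ∈ Finset.range (n₁ + n₂ + 1), c n = 1 ∧
      (∀ n, n₁ + n₂ < n → c n = 0) ∧
      (∀ n, n + n₁ + m₁ < n₂ → c n = 0) ∧
      ∀ z : ℂ, zernikeQ 0 m₁ n₁ z * zernikeQ 0 m₂ n₂ z
        = ∑ n ∈ Finset.range (n₁ + n₂ + 1), (c n : ℂ) * zernikeQ 0 ((m₁ + m₂ : ℕ) : ℤ) n z := by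
  have hdeg : ∀ k, n₁ + n₂ + 1 ≤ k → (radialPoly m₁ n₁ * radialPoly m₂ n₂).coeff k = 0 := by
    intro k hk
    rw [Polynomial.coeff_mul]
    refine Finset.sum_eq_zero fun x hx => ?_
    rw [Finset.HasAntidiagonal.mem_antidiagonal] at hx
    by_cases h : n₁ < x.1
    · rw [(radialPoly_coeff m₁ n₁).1 _ h, zero_mul]
    · rw [(radialPoly_coeff m₂ n₂).1 x.2 (by omega), mul_zero]
  obtain ⟨c, hc⟩ := exists_eq_sum_radialPoly (m₁ + m₂) (n₁ + n₂ + 1) _ hdeg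
  have hpair : ∀ k ∈ Finset.range (n₁ + n₂ + 1),
      polyIntegral (Polynomial.X ^ (m₁ + m₂) * radialPoly m₁ n₁ * radialPoly m₂ n₂ *
        radialPoly (m₁ + m₂) k) = c k * polyIntegral (Polynomial.X ^ (m₁ + m₂) *
          radialPoly (m₁ + m₂) k * radialPoly (m₁ + m₂) k) := by
    intro k hk
    rw [mul_assoc (Polynomial.X ^ _), hc, Finset.mul_sum, Finset.sum_mul, map_sum,
      Finset.sum_eq_single_of_mem k hk]
    · rw [← polyIntegral_C_mul]
      congr 1
      ring
    · intro n _ hn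
      rw [show Polynomial.X ^ (m₁ + m₂) * (Polynomial.C (c n) * radialPoly (m₁ + m₂) n) *
        radialPoly (m₁ + m₂) k = Polynomial.C (c n) * (Polynomial.X ^ (m₁ + m₂) *
          radialPoly (m₁ + m₂) n * radialPoly (m₁ + m₂) k) by ring, polyIntegral_C_mul,
        polyIntegral_radialPoly_mul_radialPoly _ _ _ hn, mul_zero]
  -- The expansion leaves `c` arbitrary beyond the degree, so it is extended by zero.
  refine ⟨fun n => if n ∈ Finset.range (n₁ + n₂ + 1) then c n else 0, ?_, ?_, ?_, ?_, ?_⟩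
  · intro n
    dsimp only
    split_ifs with hn
    · have h0 := integral_radialPoly_mul_mul_nonneg m₁ m₂ n₁ n₂ n
      change 0 ≤ polyIntegral _ at h0
      rw [hpair n hn] at h0
      exact nonneg_of_mul_nonneg_left h0 (polyIntegral_radialPoly_sq_pos _ _)
    · exact le_rfl
  · rw [Finset.sum_congr rfl fun n hn => if_pos hn]
    -- Every radial polynomial equals one at `1`, so the coefficients sum to one.
    have := congrArg (Polynomial.eval 1) hc
    simpa [Polynomial.eval_finsetSum, radialPoly_eval_one] using this.symm
  · intro n hn
    exact if_neg (by rw [Finset.mem_range]; omega)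
  · intro n hn
    dsimp only
    split_ifs with hn'
    · have h0 := hpair n hn'
      have hz : polyIntegral (Polynomial.X ^ (m₁ + m₂) * radialPoly m₁ n₁ * radialPoly m₂ n₂ *
        radialPoly (m₁ + m₂) n) = 0 := by
        -- Only the weight `X ^ m₂` is kept for `radialPoly m₂ n₂`; the remaining factor has degree
        -- at most `m₁ + n₁ + n < n₂`, so orthogonality applies.
        rw [show Polynomial.X ^ (m₁ + m₂) * radialPoly m₁ n₁ * radialPoly m₂ n₂ *
          radialPoly (m₁ + m₂) n = Polynomial.X ^ m₂ * (Polynomial.X ^ m₁ *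
            (radialPoly m₁ n₁ * radialPoly (m₁ + m₂) n)) * radialPoly m₂ n₂ by ring]
        refine polyIntegral_mul_radialPoly m₂ n₂ _ fun k hk => ?_
        rw [Polynomial.coeff_X_pow_mul', if_pos (by omega), Polynomial.coeff_mul]
        refine Finset.sum_eq_zero fun x hx => ?_
        rw [Finset.HasAntidiagonal.mem_antidiagonal] at hx
        by_cases h : n₁ < x.1
        · rw [(radialPoly_coeff m₁ n₁).1 _ h, zero_mul]
        · rw [(radialPoly_coeff (m₁ + m₂) n).1 x.2 (by omega), mul_zero]
      rw [hz] at h0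
      exact (mul_eq_zero.1 h0.symm).resolve_right (polyIntegral_radialPoly_sq_pos _ _).ne'
    · rfl
  · intro z
    have h1 := congrArg (Polynomial.eval (‖z‖ ^ 2)) hc
    have h2 : zernikeQ 0 m₁ n₁ z * zernikeQ 0 m₂ n₂ z = z ^ (m₁ + m₂) *
        (((radialPoly m₁ n₁ * radialPoly m₂ n₂).eval (‖z‖ ^ 2) : ℝ) : ℂ) := by
      rw [zernikeQ_eq, zernikeQ_eq, Polynomial.eval_mul]
      push_cast
      ring
    rw [h2, h1, Polynomial.eval_finsetSum, Complex.ofReal_sum, Finset.mul_sum]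
    refine Finset.sum_congr rfl fun n hn => ?_
    dsimp only
    rw [if_pos hn, zernikeQ_eq, Polynomial.eval_mul, Polynomial.eval_C]
    push_cast
    ring

theorem ZernikeV.summable_series {m : ℕ} (a : ZernikeV m) {z : ℂ} (hz : ‖z‖ ≤ 1) :
    Summable fun n => a n * zernikeQ 0 (m : ℤ) n z := by
  refine Summable.of_norm_bounded a.summable_norm fun n => ?_
  rw [norm_mul]
  exact mul_le_of_le_one_right (norm_nonneg _) (norm_zernikeQ_le_one m n hz)

/-- The coefficients of an absolutely summable Zernike series are unique. -/
theorem ZernikeV.eq_zero_of_series {m : ℕ} (a : ZernikeV m)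
    (h : ∀ z ∈ Metric.closedBall (0 : ℂ) 1, zernikeSeries m a z = 0) : a = 0 := by
  ext k
  have hQ : ∀ (n : ℕ) (u : ℝ), 0 ≤ u → u ≤ 1 → (((Polynomial.X ^ m * radialPoly m n *
      radialPoly m k).eval u : ℝ) : ℂ) = zernikeQ 0 m n (Real.sqrt u) * zernikeQ 0 m k (Real.sqrt u) := by
    intro n u hu _
    rw [zernikeQ_eq, zernikeQ_eq, Complex.norm_real, Real.norm_of_nonneg (Real.sqrt_nonneg u),
      Real.sq_sqrt hu]
    have hs : (u : ℂ) = (Real.sqrt u : ℂ) * Real.sqrt u := by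
      rw [← Complex.ofReal_mul, Real.mul_self_sqrt hu]
    simp only [Polynomial.eval_mul, Polynomial.eval_pow, Polynomial.eval_X]
    push_cast
    rw [hs]
    ring
  have hz : ∀ u : ℝ, 0 ≤ u → u ≤ 1 → ‖(Real.sqrt u : ℂ)‖ ≤ 1 := by
    intro u hu hu1
    rw [Complex.norm_real, Real.norm_of_nonneg (Real.sqrt_nonneg u)]
    exact Real.sqrt_le_one.2 hu1
  -- The series at `z = √u` is multiplied by `𝒬_k(√u)` and integrated in `u` term by term, with
  -- dominating terms `‖a n‖`; orthogonality then isolates `a k`.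
  have main := intervalIntegral.hasSum_integral_of_dominated_convergence
    (μ := MeasureTheory.volume) (a := 0) (b := 1)
    (F := fun n u => a n * (((Polynomial.X ^ m * radialPoly m n *
      radialPoly m k).eval u : ℝ) : ℂ)) (f := fun _ => 0) (fun n _ => ‖a n‖)
    (fun n => Continuous.aestronglyMeasurable (by fun_prop))
    (fun n => Filter.Eventually.of_forall fun u hu => by
      rw [Set.uIoc_of_le zero_le_one] at hu
      rw [hQ n u hu.1.le hu.2, norm_mul, norm_mul]
      refine mul_le_of_le_one_right (norm_nonneg _) (mul_le_one₀ ?_ (norm_nonneg _) ?_)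
      · exact norm_zernikeQ_le_one m n (hz u hu.1.le hu.2)
      · exact norm_zernikeQ_le_one m k (hz u hu.1.le hu.2))
    (Filter.Eventually.of_forall fun u _ => a.summable_norm)
    (by simp)
    (Filter.Eventually.of_forall fun u hu => by
      rw [Set.uIoc_of_le zero_le_one] at hu
      have hz' := hz u hu.1.le hu.2
      have h1 := (a.summable_series hz').hasSum.mul_right (zernikeQ 0 m k (Real.sqrt u))
      have h2 : ∑' n, a n * zernikeQ 0 (m : ℤ) n (Real.sqrt u) = 0 :=
        h _ (by simpa using hz')
      rw [h2, zero_mul] at h1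
      refine h1.congr_fun ?_
      intro n
      rw [hQ n u hu.1.le hu.2, mul_assoc])
  have hint : ∀ n, ∫ u in (0 : ℝ)..1, a n * (((Polynomial.X ^ m * radialPoly m n *
      radialPoly m k).eval u : ℝ) : ℂ)
      = a n * (polyIntegral (Polynomial.X ^ m * radialPoly m n * radialPoly m k) : ℂ) := by
    intro n
    rw [intervalIntegral.integral_const_mul, intervalIntegral.integral_ofReal]
    rfl
  simp only [hint, intervalIntegral.integral_zero] at main
  have h3 := hasSum_single (f := fun n => a n *
    (polyIntegral (Polynomial.X ^ m * radialPoly m n * radialPoly m k) : ℂ)) k (fun n hn => by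
      rw [polyIntegral_radialPoly_mul_radialPoly m n k hn]; simp)
  have h4 := h3.unique main
  rw [lp.coeFn_zero, Pi.zero_apply]
  exact (mul_eq_zero.1 h4).resolve_right
    (by exact_mod_cast (polyIntegral_radialPoly_sq_pos m k).ne')

/-! ### The convolution -/

theorem ZernikeV.norm_eq_tsum {m : ℕ} (a : ZernikeV m) : ‖a‖ = ∑' n, ‖a n‖ := by
  rw [lp.norm_eq_tsum_rpow (by simp)]
  simp

theorem ZernikeV.series_add {m : ℕ} (a b : ZernikeV m) {z : ℂ} (hz : ‖z‖ ≤ 1) :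
    zernikeSeries m (a + b) z = zernikeSeries m a z + zernikeSeries m b z := by
  unfold zernikeSeries
  rw [← (a.summable_series hz).tsum_add (b.summable_series hz)]
  refine tsum_congr fun n => ?_
  rw [lp.coeFn_add, Pi.add_apply, add_mul]

theorem ZernikeV.series_smul {m : ℕ} (c : ℂ) (a : ZernikeV m) (z : ℂ) :
    zernikeSeries m (c • a) z = c * zernikeSeries m a z := by
  unfold zernikeSeries
  rw [← tsum_mul_left]
  refine tsum_congr fun n => ?_
  rw [lp.coeFn_smul, Pi.smul_apply, smul_eq_mul, mul_assoc]

theorem ZernikeV.ext_of_series {m : ℕ} (a b : ZernikeV m)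
    (h : ∀ z ∈ Metric.closedBall (0 : ℂ) 1, zernikeSeries m a z = zernikeSeries m b z) : a = b := by
  rw [← sub_eq_zero]
  refine (a - b).eq_zero_of_series fun z hz => ?_
  rw [sub_eq_add_neg, ← neg_one_smul ℂ b, ZernikeV.series_add _ _ (by simpa using hz),
    ZernikeV.series_smul, h z hz]
  ring

/-- The evaluation of a Zernike series at a point of the closed disk. -/
def ZernikeV.evalCLM (m : ℕ) {z : ℂ} (hz : ‖z‖ ≤ 1) : ZernikeV m →L[ℂ] ℂ :=
  LinearMap.mkContinuous
    { toFun := fun a => zernikeSeries m a z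
      map_add' := fun a b => a.series_add b hz
      map_smul' := fun c a => a.series_smul c z } 1 (fun a => by
    rw [one_mul, a.norm_eq_tsum]
    refine (norm_tsum_le_tsum_norm (a.summable_series hz).norm).trans ?_
    refine Summable.tsum_le_tsum (fun n => ?_) (a.summable_series hz).norm a.summable_norm
    rw [norm_mul]
    exact mul_le_of_le_one_right (norm_nonneg _) (norm_zernikeQ_le_one m n hz))

/-- The coefficient functionals. -/
def ZernikeV.coeffCLM (m n : ℕ) : ZernikeV m →L[ℂ] ℂ :=
  LinearMap.mkContinuous
    { toFun := fun a => a n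
      map_add' := fun _ _ => rfl
      map_smul' := fun _ _ => rfl } 1 (fun a => by
    rw [one_mul]
    exact lp.norm_apply_le_norm one_ne_zero a n)

/-- The coefficients of the product of two Zernike polynomials. -/
def linearizationCoeff (m₁ m₂ n₁ n₂ : ℕ) : ℕ → ℝ := (exists_linearization m₁ m₂ n₁ n₂).choose

/-- The product of two Zernike polynomials as an element of `V^{0,m₁+m₂}`. -/
def zernikeQConv (m₁ m₂ n₁ n₂ : ℕ) : ZernikeV (m₁ + m₂) :=
  ⟨fun n => (linearizationCoeff m₁ m₂ n₁ n₂ n : ℂ), (memℓp_one_iff_summable _).2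
    (summable_of_ne_finset_zero (s := Finset.range (n₁ + n₂ + 1)) fun n hn => by
      rw [Finset.mem_range] at hn
      simp [linearizationCoeff,
        (exists_linearization m₁ m₂ n₁ n₂).choose_spec.2.2.1 n (by omega)])⟩

theorem zernikeQConv_apply (m₁ m₂ n₁ n₂ n : ℕ) :
    zernikeQConv m₁ m₂ n₁ n₂ n = (linearizationCoeff m₁ m₂ n₁ n₂ n : ℂ) := rfl

theorem zernikeQConv_apply_eq_zero (m₁ m₂ n₁ n₂ n : ℕ) (h : n + n₁ + m₁ < n₂) :
    zernikeQConv m₁ m₂ n₁ n₂ n = 0 := by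
  rw [zernikeQConv_apply, linearizationCoeff,
    (exists_linearization m₁ m₂ n₁ n₂).choose_spec.2.2.2.1 n h, Complex.ofReal_zero]

theorem norm_zernikeQConv (m₁ m₂ n₁ n₂ : ℕ) : ‖zernikeQConv m₁ m₂ n₁ n₂‖ = 1 := by
  obtain ⟨h0, h1, h2, -⟩ := (exists_linearization m₁ m₂ n₁ n₂).choose_spec
  rw [ZernikeV.norm_eq_tsum, ← h1, tsum_eq_sum (s := Finset.range (n₁ + n₂ + 1))]
  · refine Finset.sum_congr rfl fun n _ => ?_
    rw [zernikeQConv_apply, Complex.norm_real]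
    exact Real.norm_of_nonneg (h0 n)
  · intro n hn
    rw [Finset.mem_range] at hn
    rw [zernikeQConv_apply, linearizationCoeff, h2 n (by omega)]
    simp

theorem zernikeSeries_zernikeQConv (m₁ m₂ n₁ n₂ : ℕ) (z : ℂ) :
    zernikeSeries (m₁ + m₂) (zernikeQConv m₁ m₂ n₁ n₂) z
      = zernikeQ 0 m₁ n₁ z * zernikeQ 0 m₂ n₂ z := by
  obtain ⟨-, -, h2, -, h4⟩ := (exists_linearization m₁ m₂ n₁ n₂).choose_spec
  rw [h4, zernikeSeries, tsum_eq_sum (s := Finset.range (n₁ + n₂ + 1))]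
  · rfl
  · intro n hn
    rw [Finset.mem_range] at hn
    rw [zernikeQConv_apply, linearizationCoeff, h2 n (by omega)]
    simp

theorem summable_norm_smul_zernikeQConv {m₁ m₂ : ℕ} (a : ZernikeV m₁) (b : ZernikeV m₂) :
    Summable fun p : ℕ × ℕ => ‖(a p.1 * b p.2) • zernikeQConv m₁ m₂ p.1 p.2‖ := by
  simp only [norm_smul, norm_zernikeQConv, mul_one, norm_mul]
  exact a.summable_norm.mul_of_nonneg b.summable_norm (fun _ => norm_nonneg _)
    fun _ => norm_nonneg _

theorem zernikeSeries_tsum {m₁ m₂ : ℕ} (a : ZernikeV m₁) (b : ZernikeV m₂) {z : ℂ}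
    (hz : ‖z‖ ≤ 1) :
    zernikeSeries (m₁ + m₂) (∑' p : ℕ × ℕ, (a p.1 * b p.2) • zernikeQConv m₁ m₂ p.1 p.2) z
      = zernikeSeries m₁ a z * zernikeSeries m₂ b z := by
  have h1 := (ZernikeV.evalCLM (m₁ + m₂) hz).map_tsum (summable_norm_smul_zernikeQConv a b).of_norm
  have h2 : ∀ x, ZernikeV.evalCLM (m₁ + m₂) hz x = zernikeSeries (m₁ + m₂) x z := fun _ => rfl
  rw [h2] at h1
  rw [h1, zernikeSeries, zernikeSeries,
    tsum_mul_tsum_of_summable_norm (a.summable_series hz).norm (b.summable_series hz).norm]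
  refine tsum_congr fun p => ?_
  rw [h2, ZernikeV.series_smul, zernikeSeries_zernikeQConv]
  ring

/-- The double series of products of basis functions converges absolutely and represents the
product. Hence the default value `0` of the inverse transform is never taken. -/
theorem zernikeSeries_zernikeConv {m₁ m₂ : ℕ} (a : ZernikeV m₁) (b : ZernikeV m₂) :
    ∀ z ∈ Metric.closedBall (0 : ℂ) 1, zernikeSeries (m₁ + m₂) (zernikeConv m₁ m₂ a b) z
      = zernikeSeries m₁ a z * zernikeSeries m₂ b z := by
  have h : ∃ c : ZernikeV (m₁ + m₂), ∀ z ∈ Metric.closedBall (0 : ℂ) 1,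
      zernikeSeries (m₁ + m₂) c z = zernikeSeries m₁ a z * zernikeSeries m₂ b z :=
    ⟨_, fun z hz => zernikeSeries_tsum a b (by simpa using hz)⟩
  rw [zernikeConv, zernikeCoeffs, dif_pos h]
  exact h.choose_spec

theorem zernikeConv_eq_tsum {m₁ m₂ : ℕ} (a : ZernikeV m₁) (b : ZernikeV m₂) :
    zernikeConv m₁ m₂ a b = ∑' p : ℕ × ℕ, (a p.1 * b p.2) • zernikeQConv m₁ m₂ p.1 p.2 := by
  refine ZernikeV.ext_of_series _ _ fun z hz => ?_
  rw [zernikeSeries_zernikeConv a b z hz, zernikeSeries_tsum a b (by simpa using hz)]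

/-- Each product of two basis elements has norm exactly one, thanks to the nonnegative linearization
coefficients; the triangle inequality does the rest. -/
theorem norm_zernikeConv_le {m₁ m₂ : ℕ} (a : ZernikeV m₁) (b : ZernikeV m₂) :
    ‖zernikeConv m₁ m₂ a b‖ ≤ ‖a‖ * ‖b‖ := by
  rw [zernikeConv_eq_tsum, a.norm_eq_tsum, b.norm_eq_tsum,
    tsum_mul_tsum_of_summable_norm (by simpa using a.summable_norm)
      (by simpa using b.summable_norm)]
  refine (norm_tsum_le_tsum_norm (summable_norm_smul_zernikeQConv a b)).trans_eq ?_
  refine tsum_congr fun p => ?_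
  rw [norm_smul, norm_zernikeQConv, mul_one, norm_mul]

/-- Multiplication by a Zernike polynomial lowers the index by a bounded amount. -/
theorem zernikeConv_apply_eq_zero {m₁ m₂ : ℕ} (a : ZernikeV m₁) (b : ZernikeV m₂) (N K : ℕ)
    (ha : ∀ n, N < n → a n = 0) (hb : ∀ n, n ≤ K + N + m₁ → b n = 0) (n : ℕ) (hn : n ≤ K) :
    zernikeConv m₁ m₂ a b n = 0 := by
  have h1 := (ZernikeV.coeffCLM (m₁ + m₂) n).map_tsum (summable_norm_smul_zernikeQConv a b).of_norm
  rw [zernikeConv_eq_tsum]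
  refine h1.trans ?_
  refine (tsum_congr fun p => ?_).trans tsum_zero
  change a p.1 * b p.2 * zernikeQConv m₁ m₂ p.1 p.2 n = 0
  by_cases h : N < p.1
  · rw [ha _ h, zero_mul, zero_mul]
  · by_cases h' : p.2 ≤ K + N + m₁
    · rw [hb _ h', mul_zero, zero_mul]
    · rw [zernikeQConv_apply_eq_zero _ _ _ _ _ (by omega), mul_zero]

/-- The convolution as a bounded bilinear map. -/
def zernikeConvCLM (m₁ m₂ : ℕ) : ZernikeV m₁ →L[ℂ] ZernikeV m₂ →L[ℂ] ZernikeV (m₁ + m₂) :=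
  LinearMap.mkContinuous₂ (LinearMap.mk₂ ℂ (zernikeConv m₁ m₂)
    (fun a a' b => ZernikeV.ext_of_series _ _ fun z hz => by
      have hz' : ‖z‖ ≤ 1 := by simpa using hz
      rw [ZernikeV.series_add _ _ hz', zernikeSeries_zernikeConv _ _ z hz,
        zernikeSeries_zernikeConv _ _ z hz, zernikeSeries_zernikeConv _ _ z hz,
        ZernikeV.series_add _ _ hz', add_mul])
    (fun c a b => ZernikeV.ext_of_series _ _ fun z hz => by
      rw [ZernikeV.series_smul, zernikeSeries_zernikeConv _ _ z hz,
        zernikeSeries_zernikeConv _ _ z hz, ZernikeV.series_smul, mul_assoc])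
    (fun a b b' => ZernikeV.ext_of_series _ _ fun z hz => by
      have hz' : ‖z‖ ≤ 1 := by simpa using hz
      rw [ZernikeV.series_add _ _ hz', zernikeSeries_zernikeConv _ _ z hz,
        zernikeSeries_zernikeConv _ _ z hz, zernikeSeries_zernikeConv _ _ z hz,
        ZernikeV.series_add _ _ hz', mul_add])
    (fun c a b => ZernikeV.ext_of_series _ _ fun z hz => by
      rw [ZernikeV.series_smul, zernikeSeries_zernikeConv _ _ z hz,
        zernikeSeries_zernikeConv _ _ z hz, ZernikeV.series_smul, mul_left_comm]))
    1 (fun a b => by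
      rw [one_mul]
      exact norm_zernikeConv_le a b)

theorem zernikeConv_comm (m : ℕ) (a b : ZernikeV m) : zernikeConv m m a b = zernikeConv m m b a :=
  ZernikeV.ext_of_series _ _ fun z hz => by
    rw [zernikeSeries_zernikeConv _ _ z hz, zernikeSeries_zernikeConv _ _ z hz, mul_comm]

/-- `DG(W)` as a bounded operator. -/
def zernikeDGCLM (m₁ m₂ : ℕ) (W : ZernikeV m₁) : ZernikeV m₂ →L[ℂ] ZernikeV (m₁ + m₂) :=
  (2 : ℂ) • zernikeConvCLM m₁ m₂ W

theorem norm_zernikeDG_le {m₁ m₂ : ℕ} (W : ZernikeV m₁) (h : ZernikeV m₂) :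
    ‖zernikeDG m₁ m₂ W h‖ ≤ 2 * ‖W‖ * ‖h‖ := by
  rw [zernikeDG, norm_smul, mul_assoc]
  simpa using norm_zernikeConv_le W h

/-! ### Tridiagonal operators -/

/-- A column bound for tridiagonal matrices. -/
theorem tridiagonal_bound (x U D W : ℕ → ℂ) (κ : ℕ → ℝ)
    (hκ : ∀ n, ‖U n‖ + ‖D n‖ + (if n = 0 then 0 else ‖W n‖) ≤ κ n)
    (hx : Summable fun n => κ n * ‖x n‖) :
    ∑' i, ‖(if i = 0 then 0 else U (i - 1) * x (i - 1)) + D i * x i + W (i + 1) * x (i + 1)‖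
      ≤ ∑' n, κ n * ‖x n‖ := by
  have hle : ∀ {c : ℕ → ℝ}, (∀ n, 0 ≤ c n) → (∀ n, c n ≤ κ n) →
      Summable fun n => c n * ‖x n‖ := fun {c} h0 h1 =>
    Summable.of_nonneg_of_le (fun n => mul_nonneg (h0 n) (norm_nonneg _))
      (fun n => mul_le_mul_of_nonneg_right (h1 n) (norm_nonneg _)) hx
  -- Column `0` has no entry above the diagonal, so `W 0` must not be counted.
  have hW0 : ∀ n, 0 ≤ if n = 0 then 0 else ‖W n‖ := fun n => by split_ifs <;> positivity
  have sU := hle (c := fun n => ‖U n‖) (fun n => norm_nonneg _) fun n => by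
    linarith [hκ n, norm_nonneg (D n), hW0 n]
  have sD := hle (c := fun n => ‖D n‖) (fun n => norm_nonneg _) fun n => by
    linarith [hκ n, norm_nonneg (U n), hW0 n]
  have sW := hle (c := fun n => if n = 0 then 0 else ‖W n‖) hW0 fun n => by
    linarith [hκ n, norm_nonneg (U n), norm_nonneg (D n)]
  have sU' : Summable fun i : ℕ => ‖(if i = 0 then 0 else U (i - 1) * x (i - 1))‖ := by
    refine (summable_nat_add_iff 1).1 ?_
    simpa using sU
  have eU : ∑' i : ℕ, ‖(if i = 0 then 0 else U (i - 1) * x (i - 1))‖ = ∑' n, ‖U n‖ * ‖x n‖ := by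
    rw [sU'.tsum_eq_zero_add]
    simp
  have sW' : Summable fun i : ℕ => ‖W (i + 1)‖ * ‖x (i + 1)‖ := by
    simpa using (summable_nat_add_iff 1).2 sW
  have eW : ∑' i : ℕ, ‖W (i + 1)‖ * ‖x (i + 1)‖ = ∑' n, (if n = 0 then 0 else ‖W n‖) * ‖x n‖ := by
    rw [sW.tsum_eq_zero_add]
    simp
  have hb : ∀ i, ‖(if i = 0 then 0 else U (i - 1) * x (i - 1)) + D i * x i + W (i + 1) * x (i + 1)‖
      ≤ ‖(if i = 0 then 0 else U (i - 1) * x (i - 1))‖ + ‖D i‖ * ‖x i‖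
        + ‖W (i + 1)‖ * ‖x (i + 1)‖ := fun i => by
    rw [← norm_mul, ← norm_mul]
    exact norm_add₃_le
  have hs := (sU'.add sD).add sW'
  refine (Summable.tsum_le_tsum hb
    (Summable.of_nonneg_of_le (fun _ => norm_nonneg _) hb hs) hs).trans ?_
  rw [(sU'.add sD).tsum_add sW', sU'.tsum_add sD, eU, eW, ← sU.tsum_add sD,
    ← (sU.add sD).tsum_add sW]
  refine Summable.tsum_le_tsum (fun n => ?_) ((sU.add sD).add sW) hx
  rw [← add_mul, ← add_mul]
  exact mul_le_mul_of_nonneg_right (hκ n) (norm_nonneg _)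

theorem tridiagonal_bound_const {m : ℕ} (a : ZernikeV m) (U D W : ℕ → ℂ) (C : ℝ)
    (hC : ∀ n, ‖U n‖ + ‖D n‖ + (if n = 0 then 0 else ‖W n‖) ≤ C) :
    ∑' i, ‖(if i = 0 then 0 else U (i - 1) * a (i - 1)) + D i * a i + W (i + 1) * a (i + 1)‖
      ≤ C * ‖a‖ := by
  rw [a.norm_eq_tsum, ← tsum_mul_left]
  exact tridiagonal_bound a U D W (fun _ => C) hC (a.summable_norm.mul_left C)

/-- The columns of `Δ₀⁻¹` are bounded. -/
theorem norm_invLap_column_le (m n : ℕ) :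
    ‖(invLapUp m n : ℂ)‖ + ‖(invLapDiag m n : ℂ)‖ + (if n = 0 then 0 else ‖(invLapDown m n : ℂ)‖)
      ≤ 3 * (1 / ((n : ℝ) + 1) ^ 2) := by
  have h1 := abs_invLapUp_le m n
  have h2 := abs_invLapDiag_le m n
  have h0 : (0 : ℝ) ≤ 1 / ((n : ℝ) + 1) ^ 2 := by positivity
  simp only [Complex.norm_real, Real.norm_eq_abs]
  split_ifs with h
  · linarith
  · linarith [abs_invLapDown_le m n h]

theorem invLapSeq_add (m : ℕ) (x y : ℕ → ℂ) (i : ℕ) :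
    invLapSeq m (x + y) i = invLapSeq m x i + invLapSeq m y i := by
  simp only [invLapSeq, Pi.add_apply]
  split_ifs <;> ring

theorem invLapSeq_smul (m : ℕ) (c : ℂ) (x : ℕ → ℂ) (i : ℕ) :
    invLapSeq m (c • x) i = c * invLapSeq m x i := by
  simp only [invLapSeq, Pi.smul_apply, smul_eq_mul]
  split_ifs <;> ring

/-- `Δ₀⁻¹` as a bounded operator. -/
def invLapCLM (m : ℕ) : ZernikeV m →L[ℂ] ZernikeV m :=
  LinearMap.mkContinuous
    { toFun := invLap m
      map_add' := fun a b => by ext i; exact invLapSeq_add m a b i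
      map_smul' := fun c a => by ext i; exact invLapSeq_smul m c a i } 3 (fun a => by
    change ‖invLap m a‖ ≤ _
    rw [ZernikeV.norm_eq_tsum]
    refine tridiagonal_bound_const a (fun n => invLapUp m n) (fun n => invLapDiag m n)
      (fun n => invLapDown m n) 3 fun n => (norm_invLap_column_le m n).trans ?_
    have : 1 / ((n : ℝ) + 1) ^ 2 ≤ 1 := by
      rw [div_le_one (by positivity)]
      nlinarith [(n.cast_nonneg : (0 : ℝ) ≤ n)]
    linarith)

theorem zernikeTrunc_apply {m : ℕ} (N : ℕ) (a : ZernikeV m) (n : ℕ) :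
    zernikeTrunc m N a n = if n ≤ N then a n else 0 := rfl

/-- The tail of `Δ₀⁻¹` is small. -/
theorem norm_invLap_sub_trunc_le (m N : ℕ) (hN : 1 ≤ N) (a : ZernikeV m) :
    ‖invLap m a - zernikeTrunc m N (invLap m a)‖ ≤ 1 / (2 * ((N : ℝ) + 1) + m) ^ 2 * ‖a‖ := by
  have hm : (0 : ℝ) ≤ m := m.cast_nonneg
  have hNr : (1 : ℝ) ≤ N := by exact_mod_cast hN
  rw [ZernikeV.norm_eq_tsum]
  -- Column `n` has entries in rows `n + 1`, `n`, `n - 1`; each band is kept only where its row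
  -- exceeds `N`.
  refine le_of_eq_of_le (tsum_congr fun i => ?_) (tridiagonal_bound_const a
    (fun n => if N < n + 1 then invLapUp m n else 0) (fun n => if N < n then invLapDiag m n else 0)
    (fun n => if N < n - 1 then invLapDown m n else 0) _ fun n => ?_)
  · rw [lp.coeFn_sub, Pi.sub_apply, zernikeTrunc_apply]
    change ‖invLapSeq m a i - (if i ≤ N then invLapSeq m a i else 0)‖ = _
    unfold invLapSeq
    by_cases h : i ≤ N
    · have h1 : ¬ N < i - 1 + 1 ∨ i = 0 := by omega
      rcases h1 with h1 | h1
      · simp [h, h1, show ¬ N < i by omega]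
      · subst h1; simp
    · have h1 : N < i - 1 + 1 := by omega
      simp [h, h1, show N < i by omega]
  -- With `q = 2(N+1) + m`, every column sum must be at most `1 / q ^ 2`. Column `N` keeps one
  -- entry, column `N + 1` two, the later ones all three, and the earlier ones none.
  · rcases lt_trichotomy n (N + 1) with h | h | h
    · rw [if_neg (show ¬ N < n by omega), if_neg (show ¬ N < n - 1 by omega)]
      by_cases hn : n = N
      · subst hn
        rw [if_pos (by omega), Complex.norm_real, Real.norm_eq_abs, invLapUp,
          abs_of_nonneg (by positivity)]
        simp only [norm_zero, ite_self, add_zero]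
        refine one_div_le_one_div_of_le (by positivity) ?_
        nlinarith
      · rw [if_neg (by omega)]
        simp only [norm_zero, ite_self, add_zero]
        positivity
    · subst h
      rw [if_pos (show N < N + 1 + 1 by omega), if_pos (show N < N + 1 by omega),
        if_neg (show ¬ N < N + 1 - 1 by omega), invLapUp, invLapDiag,
        if_neg (show ¬ N + 1 = 0 by omega), if_neg (show ¬ N + 1 = 0 by omega),
        Complex.norm_real, Complex.norm_real, Real.norm_eq_abs, Real.norm_eq_abs, neg_div, abs_neg,
        abs_of_nonneg (by positivity), abs_of_nonneg (by positivity), norm_zero, add_zero]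
      push_cast
      generalize hq : 2 * ((N : ℝ) + 1) + m = q
      have hq4 : 4 ≤ q := by rw [← hq]; linarith
      rw [div_add_div _ _ (by positivity) (by positivity), div_le_div_iff₀ (by positivity)
        (by positivity)]
      nlinarith [mul_pos (show 0 < q by linarith) (show 0 < q by linarith),
        pow_pos (show 0 < q by linarith) 3, pow_pos (show 0 < q by linarith) 4]
    · rw [if_pos (show N < n + 1 by omega), if_pos (show N < n by omega),
        if_pos (show N < n - 1 by omega), if_neg (show ¬ n = 0 by omega), invLapUp,
        invLapDiag, invLapDown, if_neg (show ¬ n = 0 by omega), Complex.norm_real, Complex.norm_real,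
        Complex.norm_real, Real.norm_eq_abs, Real.norm_eq_abs, Real.norm_eq_abs,
        neg_div, abs_neg, abs_of_nonneg (by positivity)]
      have hn : (N : ℝ) + 2 ≤ n := by exact_mod_cast h
      generalize hp : 2 * (n : ℝ) + m = p
      have hp4 : 2 * ((N : ℝ) + 1) + m + 2 ≤ p := by rw [← hp]; linarith
      have hp0 : 0 < p := by linarith
      rw [abs_of_nonneg (by positivity), abs_of_nonneg (by positivity)]
      -- A full column sums to `1 / (p (p + 2))`, and `p ≥ q + 2` here.
      have e : 1 / (4 * (p + 1) * (p + 2)) + 1 / (2 * (p + 2) * p) + 1 / (4 * p * (p + 1))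
          = 1 / (p * (p + 2)) := by
        field_simp
        ring
      rw [e]
      refine one_div_le_one_div_of_le (by positivity) ?_
      nlinarith

/-! ### Multiplication by `z̄` and `z` -/

theorem norm_natCast_ratio_add (a b c : ℕ) (h : a + b ≤ c) :
    ‖(a : ℂ) / c‖ + ‖(b : ℂ) / c‖ ≤ 1 := by
  rw [norm_div, norm_div, ← add_div]
  simp only [Complex.norm_natCast]
  exact div_le_one_of_le₀ (by exact_mod_cast h) (by positivity)

/-- The two entries of each column are nonnegative with sum `((n + 1) + (n + m + 1)) / (2n + m + 2)
= 1`. -/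
theorem norm_rMinus_le {m : ℕ} (a : ZernikeV (m + 1)) : ‖rMinus m a‖ ≤ ‖a‖ := by
  rw [ZernikeV.norm_eq_tsum (rMinus m a), ← one_mul ‖a‖]
  refine le_of_eq_of_le (tsum_congr fun i => ?_) (tridiagonal_bound_const a
    (fun n => ((n + 1 : ℕ) : ℂ) / (2 * n + m + 2 : ℕ))
    (fun n => ((n + m + 1 : ℕ) : ℂ) / (2 * n + m + 2 : ℕ)) (fun _ => 0) 1 fun n => ?_)
  · change ‖rMinusSeq m a i‖ = _
    unfold rMinusSeq
    rw [zero_mul, add_zero]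
    congr 2
    · cases i with
      | zero => simp
      | succ i =>
        simp only [Nat.add_eq_zero_iff, one_ne_zero, and_false, if_false, Nat.add_sub_cancel]
        push_cast
        ring_nf
    · push_cast
      ring
  · simp only [norm_zero, ite_self, add_zero]
    exact norm_natCast_ratio_add _ _ _ (by omega)

theorem rMinusSeq_add (m : ℕ) (x y : ℕ → ℂ) (i : ℕ) :
    rMinusSeq m (x + y) i = rMinusSeq m x i + rMinusSeq m y i := by
  simp only [rMinusSeq, Pi.add_apply]
  split_ifs <;> ring

theorem rMinusSeq_smul (m : ℕ) (c : ℂ) (x : ℕ → ℂ) (i : ℕ) :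
    rMinusSeq m (c • x) i = c * rMinusSeq m x i := by
  simp only [rMinusSeq, Pi.smul_apply, smul_eq_mul]
  split_ifs <;> ring

/-- `R⁻` as a bounded operator. -/
def rMinusCLM (m : ℕ) : ZernikeV (m + 1) →L[ℂ] ZernikeV m :=
  LinearMap.mkContinuous
    { toFun := rMinus m
      map_add' := fun a b => by ext i; exact rMinusSeq_add m a b i
      map_smul' := fun c a => by ext i; exact rMinusSeq_smul m c a i } 1 (fun a => by
    rw [one_mul]
    exact norm_rMinus_le a)

/-- `(R⁻)^j` as a bounded operator. -/
def rMinusPowCLM (m : ℕ) : (j : ℕ) → ZernikeV (m + j) →L[ℂ] ZernikeV m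
  | 0 => ContinuousLinearMap.id ℂ _
  | j + 1 => (rMinusPowCLM m j).comp (rMinusCLM (m + j))

theorem rMinusPowCLM_apply (m j : ℕ) (a : ZernikeV (m + j)) :
    rMinusPowCLM m j a = rMinusPow m j a := by
  induction j with
  | zero => rfl
  | succ j ih => exact ih (rMinus (m + j) a)

theorem norm_rMinusPow_le (m j : ℕ) (a : ZernikeV (m + j)) : ‖rMinusPow m j a‖ ≤ ‖a‖ := by
  induction j with
  | zero => exact le_rfl
  | succ j ih => exact (ih (rMinus (m + j) a)).trans (norm_rMinus_le (m := m + j) a)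

/-- Multiplication by `z̄` maps index `n` to `n` and `n + 1`, never below. -/
theorem rMinusPow_apply_eq_zero (m j K : ℕ) (a : ZernikeV (m + j)) (h : ∀ n, n ≤ K → a n = 0)
    (n : ℕ) (hn : n ≤ K) : rMinusPow m j a n = 0 := by
  induction j with
  | zero => exact h n hn
  | succ j ih =>
    refine ih (rMinus (m + j) a) fun i hi => ?_
    change rMinusSeq (m + j) a i = 0
    unfold rMinusSeq
    rw [h i hi, h (i - 1) (by omega)]
    simp

theorem invLap_apply_eq_zero (m K : ℕ) (a : ZernikeV m) (h : ∀ n, n ≤ K + 1 → a n = 0)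
    (n : ℕ) (hn : n ≤ K) : invLap m a n = 0 := by
  change invLapSeq m a n = 0
  unfold invLapSeq
  rw [h n (by omega), h (n - 1) (by omega), h (n + 1) (by omega)]
  simp

theorem summable_norm_rPlusSeq {m : ℕ} (a : ZernikeV m) : Summable fun n => ‖rPlusSeq m a n‖ := by
  have h2 := (summable_nat_add_iff 1).2 a.summable_norm
  refine Summable.of_nonneg_of_le (fun _ => norm_nonneg _) (fun n => ?_) (a.summable_norm.add h2)
  refine (norm_add_le _ _).trans (add_le_add ?_ ?_)
  · rw [norm_mul]
    refine mul_le_of_le_one_left (norm_nonneg _) ?_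
    have := norm_ratCast_div_le_one (a := (n : ℝ) + m + 1) (b := 2 * (n : ℝ) + m + 1)
      (by positivity) (by linarith [(n.cast_nonneg : (0 : ℝ) ≤ n)])
    push_cast at this
    exact this
  · rw [norm_mul]
    refine mul_le_of_le_one_left (norm_nonneg _) ?_
    have := norm_ratCast_div_le_one (a := (n : ℝ) + 1) (b := 2 * ((n : ℝ) + 1) + m + 1)
      (by positivity) (by
        linarith [(n.cast_nonneg : (0 : ℝ) ≤ n), (m.cast_nonneg : (0 : ℝ) ≤ m)])
    push_cast at this
    exact this

/-- `R⁺ : V^{0,m} → V^{0,m+1}`, the multiplication by `z`. -/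
def rPlus (m : ℕ) (a : ZernikeV m) : ZernikeV (m + 1) :=
  ⟨rPlusSeq m a, (memℓp_one_iff_summable _).2 (summable_norm_rPlusSeq a)⟩

theorem zernikeSeries_rPlus {m : ℕ} (a : ZernikeV m) {z : ℂ} (hz : ‖z‖ ≤ 1) :
    zernikeSeries (m + 1) (rPlus m a) z = z * zernikeSeries m a z := by
  have hb : ∀ (c : ℕ → ℂ) (k : ℕ → ℕ), (∀ n, ‖c n‖ ≤ 1) →
      Summable fun n => a n * (c n * zernikeQ 0 ((m + 1 : ℕ) : ℤ) (k n) z) := fun c k hc => by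
    refine Summable.of_norm_bounded a.summable_norm fun n => ?_
    rw [norm_mul, norm_mul]
    exact mul_le_of_le_one_right (norm_nonneg _)
      (mul_le_one₀ (hc n) (norm_nonneg _) (norm_zernikeQ_le_one _ _ hz))
  have s1 := hb (fun n => ((n : ℂ) + m + 1) / (2 * n + m + 1)) (fun n => n) (fun n => by
    have := norm_ratCast_div_le_one (a := (n : ℝ) + m + 1) (b := 2 * (n : ℝ) + m + 1)
      (by positivity) (by linarith [(n.cast_nonneg : (0 : ℝ) ≤ n)])
    push_cast at this
    exact this)
  have s2 := hb (fun n => (n : ℂ) / (2 * n + m + 1)) (fun n => n - 1) (fun n => by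
    have := norm_ratCast_div_le_one (a := (n : ℝ)) (b := 2 * (n : ℝ) + m + 1)
      (by positivity) (by
        linarith [(n.cast_nonneg : (0 : ℝ) ≤ n), (m.cast_nonneg : (0 : ℝ) ≤ m)])
    push_cast at this
    exact this)
  have s2' := (summable_nat_add_iff 1).2 s2
  have e : z * zernikeSeries m a z
      = ∑' n, (a n * (((n : ℂ) + m + 1) / (2 * n + m + 1) * zernikeQ 0 ((m + 1 : ℕ) : ℤ) n z)
        + a n * ((n : ℂ) / (2 * n + m + 1) * zernikeQ 0 ((m + 1 : ℕ) : ℤ) (n - 1) z)) := by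
    rw [zernikeSeries, ← tsum_mul_left]
    refine tsum_congr fun n => ?_
    rw [← mul_add, ← mul_zernikeQ]
    ring
  -- The term `n = 0` with its truncated index `n - 1` carries the coefficient `0`; it is split off
  -- before the shift.
  rw [e, s1.tsum_add s2, s2.tsum_eq_zero_add]
  simp only [Nat.cast_zero, zero_div, zero_mul, mul_zero, zero_add]
  rw [← s1.tsum_add s2', zernikeSeries]
  refine tsum_congr fun n => ?_
  change rPlusSeq m a n * _ = _
  rw [rPlusSeq, Nat.add_sub_cancel]
  push_cast
  ring

/-- On arbitrary sequences `R⁺_{0,1}` has the kernel spanned by `(-1)^j (j + 1)^2`, so being a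
preimage of `f` does not determine `c`. For `c` in `ℓ¹` the series defining the inverse telescopes
to `T i - T n`, and the boundary term `T n` tends to zero. -/
theorem rPlusOneInv_eq (f : ZernikeV 2) (c : ZernikeV 1) (h : (f : ℕ → ℂ) = rPlusSeq 1 c) (i : ℕ) :
    rPlusOneInv f i = c i := by
  have hs := (summable_rPlusOneInvMat_mul f i).hasSum.tendsto_sum_nat
  let T : ℕ → ℂ := fun j => (-1) ^ (j + i) * (((i : ℂ) + 1) ^ 2 / ((j : ℂ) + 1) ^ 2) * c j
  have hterm : ∀ j, i ≤ j → rPlusOneInvMat i j * f j = T j - T (j + 1) := by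
    intro j hj
    have h1 : (j : ℂ) + 1 ≠ 0 := by exact_mod_cast Nat.succ_ne_zero j
    have h2 : (j : ℂ) + 2 ≠ 0 := by exact_mod_cast Nat.succ_ne_zero (j + 1)
    have e1 : 2 * (j : ℂ) + 1 + 1 = 2 * (j + 1) := by ring
    have e2 : 2 * ((j : ℂ) + 1) + 1 + 1 = 2 * (j + 2) := by ring
    have e3 : (j : ℂ) + 1 + 1 = j + 2 := by ring
    rw [h, rPlusOneInvMat, if_pos hj, rPlusSeq]
    simp only [T]
    rw [show j + 1 + i = j + i + 1 by ring, pow_succ]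
    push_cast
    rw [e1, e2, e3]
    field_simp
    ring
  have hpart : ∀ n, i ≤ n → ∑ j ∈ Finset.range n, rPlusOneInvMat i j * f j = T i - T n := by
    intro n hn
    induction n, hn using Nat.le_induction with
    | base =>
      rw [sub_self]
      refine Finset.sum_eq_zero fun j hj => ?_
      rw [Finset.mem_range] at hj
      rw [rPlusOneInvMat, if_neg (by omega), zero_mul]
    | succ n hn ih =>
      rw [Finset.sum_range_succ, ih, hterm n hn]
      ring
  have hT0 : Filter.Tendsto T Filter.atTop (nhds 0) := by
    have h1 : Filter.Tendsto (fun n => ((i : ℝ) + 1) ^ 2 * ‖c n‖) Filter.atTop (nhds 0) := by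
      simpa using c.summable_norm.tendsto_atTop_zero.const_mul (((i : ℝ) + 1) ^ 2)
    refine squeeze_zero_norm (fun n => ?_) h1
    simp only [T, norm_mul, norm_pow, norm_neg, norm_one, one_pow, one_mul, norm_div]
    have e1 : ‖(n : ℂ) + 1‖ = (n : ℝ) + 1 := by
      exact_mod_cast Complex.norm_natCast (n + 1)
    have e2 : ‖(i : ℂ) + 1‖ = (i : ℝ) + 1 := by
      exact_mod_cast Complex.norm_natCast (i + 1)
    rw [e1, e2]
    refine mul_le_mul_of_nonneg_right (div_le_self (by positivity) ?_) (norm_nonneg _)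
    nlinarith [(n.cast_nonneg : (0 : ℝ) ≤ n)]
  have hlim : Filter.Tendsto (fun n => T i - T n) Filter.atTop (nhds (T i)) := by
    simpa using hT0.const_sub (T i)
  have hTi : T i = c i := by
    have h1 : (i : ℂ) + 1 ≠ 0 := by exact_mod_cast Nat.succ_ne_zero i
    simp only [T]
    rw [Even.neg_one_pow ⟨i, rfl⟩, div_self (pow_ne_zero 2 h1)]
    ring
  rw [← hTi]
  refine tendsto_nhds_unique hs (hlim.congr' ?_)
  filter_upwards [Filter.eventually_ge_atTop i] with n hn
  exact (hpart n hn).symm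

/-- `Δ₀⁻¹ (R⁺_{0,1})⁻¹ DG(R⁺_{0,0} W) = Δ₀⁻¹ DG(W)` on `V^{0,1}`. -/
theorem linTermNegOne_eq (U : ZernikeV 1) (W : ZernikeV 0) (hW : rPlusSeq 0 W = U)
    (h : ZernikeV 1) : linTermNegOne U h = invLap 1 (zernikeDG 0 1 W h) := by
  have hU : U = rPlus 0 W := by
    ext i
    exact (congrFun hW i).symm
  -- Both sides represent the function `z 𝓜[W] 𝓜[h]`, and Zernike coefficients are unique.
  have h1 : zernikeConv 1 1 U h = rPlus 1 (zernikeConv 0 1 W h) := by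
    refine ZernikeV.ext_of_series (m := 2) _ _ fun z hz => ?_
    have hz' : ‖z‖ ≤ 1 := by simpa using hz
    refine (zernikeSeries_zernikeConv U h z hz).trans ?_
    refine Eq.trans ?_ (zernikeSeries_rPlus (m := 1) (zernikeConv 0 1 W h) hz').symm
    have e1 : zernikeSeries 1 U z = z * zernikeSeries 0 W z := by
      rw [hU]
      exact zernikeSeries_rPlus W hz'
    have e2 : zernikeSeries 1 (zernikeConv 0 1 W h) z = zernikeSeries 0 W z * zernikeSeries 1 h z :=
      zernikeSeries_zernikeConv W h z hz
    rw [e1, e2, mul_assoc]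
  have h2 : ((zernikeDG 1 1 U h : ZernikeV 2) : ℕ → ℂ)
      = rPlusSeq 1 (zernikeDG 0 1 W h : ZernikeV 1) := by
    funext i
    change (2 : ℂ) * zernikeConv 1 1 U h i = _
    rw [h1]
    change (2 : ℂ) * rPlusSeq 1 (zernikeConv 0 1 W h) i = rPlusSeq 1 _ i
    have : ∀ j, (zernikeDG 0 1 W h : ZernikeV 1) j = 2 * zernikeConv 0 1 W h j := fun j => rfl
    simp only [rPlusSeq, this]
    ring
  have h3 : rPlusOneInv (zernikeDG 1 1 U h) = (zernikeDG 0 1 W h : ZernikeV 1) :=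
    funext fun i => rPlusOneInv_eq _ _ h2 i
  ext i
  change invLapSeq 1 (rPlusOneInv (zernikeDG 1 1 U h)) i = invLapSeq 1 _ i
  rw [h3]

theorem rPlusOneInv_add (f g : ZernikeV 2) :
    rPlusOneInv (f + g) = rPlusOneInv f + rPlusOneInv g := by
  funext i
  rw [Pi.add_apply, rPlusOneInv, rPlusOneInv, rPlusOneInv,
    ← (summable_rPlusOneInvMat_mul f i).tsum_add (summable_rPlusOneInvMat_mul g i)]
  refine tsum_congr fun j => ?_
  rw [lp.coeFn_add, Pi.add_apply, mul_add]

theorem rPlusOneInv_smul (c : ℂ) (f : ZernikeV 2) : rPlusOneInv (c • f) = c • rPlusOneInv f := by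
  funext i
  rw [Pi.smul_apply, rPlusOneInv, rPlusOneInv, smul_eq_mul, ← tsum_mul_left]
  refine tsum_congr fun j => ?_
  rw [lp.coeFn_smul, Pi.smul_apply, smul_eq_mul]
  ring

/-- The sequence `(R⁺_{0,1})⁻¹ f` is only bounded, not summable; the decay of the columns of `Δ₀⁻¹`
supplies the weight that makes it summable. -/
theorem norm_rPlusOneInv_le (f : ZernikeV 2) (i : ℕ) :
    1 / ((i : ℝ) + 1) ^ 2 * ‖rPlusOneInv f i‖ ≤ 2 / (((i : ℝ) + 1) * (i + 2)) * ‖f‖ := by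
  have h1 : ‖rPlusOneInv f i‖ ≤ ∑' j, ‖rPlusOneInvMat i j * f j‖ :=
    norm_tsum_le_tsum_norm (summable_rPlusOneInvMat_mul f i).norm
  refine (mul_le_mul_of_nonneg_left h1 (by positivity)).trans ?_
  rw [f.norm_eq_tsum, ← tsum_mul_left, ← tsum_mul_left]
  refine Summable.tsum_le_tsum (fun j => ?_)
    ((summable_rPlusOneInvMat_mul f i).norm.mul_left _) (f.summable_norm.mul_left _)
  rw [norm_mul, ← mul_assoc]
  exact mul_le_mul_of_nonneg_right (norm_rPlusOneInvMat_le i j) (norm_nonneg _)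

/-- `Δ₀⁻¹ (R⁺_{0,1})⁻¹` as a bounded operator. -/
def invLapRPlusOneInvCLM : ZernikeV 2 →L[ℂ] ZernikeV 1 :=
  LinearMap.mkContinuous
    { toFun := invLapRPlusOneInv
      map_add' := fun f g => by
        ext i
        change invLapSeq 1 (rPlusOneInv (f + g)) i = _
        rw [rPlusOneInv_add, invLapSeq_add]
        rfl
      map_smul' := fun c f => by
        ext i
        change invLapSeq 1 (rPlusOneInv (c • f)) i = _
        rw [rPlusOneInv_smul, invLapSeq_smul]
        rfl } (∑' n : ℕ, 6 * (1 / ((n : ℝ) + 1) ^ 2)) (fun f => by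
    -- The constant `6` is the column constant `3` of `Δ₀⁻¹` times the bound `2` on the entries of
    -- `(R⁺_{0,1})⁻¹ f` relative to `‖f‖`. Only continuity is needed here; the sharp estimate goes
    -- through `linTermNegOne_eq`.
    change ‖invLapRPlusOneInv f‖ ≤ _
    have hs : Summable fun n : ℕ => 6 * (1 / ((n : ℝ) + 1) ^ 2) * ‖f‖ := by
      have h0 := (summable_nat_add_iff 1).2 (Real.summable_one_div_nat_pow.2 one_lt_two)
      push_cast at h0
      exact (h0.mul_left _).mul_right _
    have hle : ∀ n : ℕ, 3 * (1 / ((n : ℝ) + 1) ^ 2) * ‖rPlusOneInv f n‖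
        ≤ 6 * (1 / ((n : ℝ) + 1) ^ 2) * ‖f‖ := fun n => by
      have h1 := norm_rPlusOneInv_le f n
      have h2 : 2 / (((n : ℝ) + 1) * (n + 2)) ≤ 2 * (1 / ((n : ℝ) + 1) ^ 2) := by
        rw [← mul_div_assoc, mul_one, pow_two]
        gcongr
        norm_num
      nlinarith [mul_le_mul_of_nonneg_right h2 (norm_nonneg f)]
    have hs' := Summable.of_nonneg_of_le (fun n => by positivity) hle hs
    rw [ZernikeV.norm_eq_tsum, ← tsum_mul_right]
    refine (tridiagonal_bound (rPlusOneInv f) (fun n => invLapUp 1 n) (fun n => invLapDiag 1 n)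
      (fun n => invLapDown 1 n) _ (norm_invLap_column_le 1) hs').trans ?_
    exact Summable.tsum_le_tsum hle hs' hs)

/-! ### The operator bound -/

theorem norm_le_of_l1OpNorm_le {m₁ m₂ : ℕ} (T : ZernikeV m₁ →L[ℂ] ZernikeV m₂) (Z : ℝ≥0)
    (hT : l1OpNorm (fun h => T h) ≤ Z) : ‖T‖ ≤ Z := by
  refine ContinuousLinearMap.opNorm_le_of_unit_norm Z.2 fun h hh => ?_
  have h1 : ‖T h‖ₑ ≤ Z :=
    (le_iSup₂ (f := fun (h : ZernikeV m₁) (_ : ‖h‖ ≤ 1) => ‖T h‖ₑ) h hh.le).trans hT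
  rw [← ofReal_norm] at h1
  exact (ENNReal.ofReal_le_coe).1 h1

/-- Additivity of the `ℓ¹` norm over disjoint supports is the reason why a maximum, not a sum,
appears in `Z₁`. -/
theorem norm_trunc_add_norm_sub {m : ℕ} (N : ℕ) (h : ZernikeV m) :
    ‖zernikeTrunc m N h‖ + ‖h - zernikeTrunc m N h‖ = ‖h‖ := by
  rw [ZernikeV.norm_eq_tsum, ZernikeV.norm_eq_tsum (h - _), ZernikeV.norm_eq_tsum h,
    ← (ZernikeV.summable_norm _).tsum_add (ZernikeV.summable_norm _)]
  refine tsum_congr fun n => ?_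
  rw [lp.coeFn_sub, Pi.sub_apply, zernikeTrunc_apply]
  split_ifs <;> simp

/-- The bound on `I - A (I + T)` by the finite part, the coupling part and the tail. -/
theorem norm_id_sub_approxInv_comp_le {m N N' : ℕ} (AN T : ZernikeV m →L[ℂ] ZernikeV m)
    (hAN : zernikeTrunc m N ∘L AN ∘L zernikeTrunc m N = AN) (Z₀ Z₁ : ℝ≥0) (ε : ℝ) (hε : 0 ≤ ε)
    (h0 : ∀ h, zernikeTrunc m N h = h → ‖h - AN (h + T h)‖ ≤ Z₀ * ‖h‖)
    (h1 : max (Z₀ : ℝ≥0∞) (l1OpNorm (fun h : ZernikeV m =>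
      AN (T (zernikeTrunc m N' h - zernikeTrunc m N h)))) + ENNReal.ofReal ε ≤ Z₁)
    (h2 : ∀ h : ZernikeV m, (∀ n, n ≤ N' → h n = 0) → ∀ n, n ≤ N → T h n = 0)
    (h3 : ∀ h, ‖T h - zernikeTrunc m N (T h)‖ ≤ ε * ‖h‖) :
    ‖ContinuousLinearMap.id ℂ (ZernikeV m)
      - approxInv m N AN ∘L (ContinuousLinearMap.id ℂ (ZernikeV m) + T)‖ ≤ Z₁ := by
  have hANtr : ∀ h, AN (zernikeTrunc m N h) = AN h := fun h => by
    conv_rhs => rw [← hAN]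
    conv_lhs => rw [← hAN]
    simp only [ContinuousLinearMap.comp_apply]
    congr 2
    ext n
    simp only [zernikeTrunc_apply]
    split_ifs <;> rfl
  -- The supremum is taken in `[0, ∞]`; the hypothesis on `Z₁` forces it to be finite.
  have hXfin : l1OpNorm (fun h : ZernikeV m =>
      AN (T (zernikeTrunc m N' h - zernikeTrunc m N h))) ≠ ∞ := by
    refine ne_top_of_le_ne_top (ENNReal.coe_ne_top (r := Z₁)) (le_trans ?_ h1)
    exact (le_max_right _ _).trans le_self_add
  obtain ⟨X, hX⟩ : ∃ X : ℝ≥0, (X : ℝ≥0∞) = l1OpNorm (fun h : ZernikeV m =>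
      AN (T (zernikeTrunc m N' h - zernikeTrunc m N h))) := ⟨_, ENNReal.coe_toNNReal hXfin⟩
  rw [← hX] at h1
  have hXT := norm_le_of_l1OpNorm_le (AN ∘L T ∘L (zernikeTrunc m N' - zernikeTrunc m N)) X hX.ge
  have hsum : (max Z₀ X : ℝ≥0) + ε ≤ Z₁ := by
    rw [← Real.coe_toNNReal ε hε]
    rw [ENNReal.ofReal] at h1
    exact_mod_cast h1
  refine ContinuousLinearMap.opNorm_le_bound _ Z₁.2 fun h => ?_
  set p := zernikeTrunc m N h with hp
  set q := h - p with hq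
  have htr : ∀ n, n ≤ N → q n = 0 := fun n hn => by
    rw [hq, lp.coeFn_sub, Pi.sub_apply, hp, zernikeTrunc_apply, if_pos hn, sub_self]
  have hpq : zernikeTrunc m N q = 0 := by
    ext n
    rw [zernikeTrunc_apply]
    split_ifs with hn
    · exact htr n hn
    · rfl
  have hpp : zernikeTrunc m N p = p := by
    have : zernikeTrunc m N h = zernikeTrunc m N p + zernikeTrunc m N q := by
      rw [← map_add, hq, add_sub_cancel]
    rw [hpq, add_zero] at this
    exact this.symm
  have hdec : (ContinuousLinearMap.id ℂ (ZernikeV m)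
      - approxInv m N AN ∘L (ContinuousLinearMap.id ℂ (ZernikeV m) + T)) h
      = (p - AN (p + T p)) - AN (T (zernikeTrunc m N' q - zernikeTrunc m N q))
        - (T h - zernikeTrunc m N (T h)) := by
    -- Coefficients beyond `N'` are mapped by `T` to indices beyond `N`, where `AN` vanishes.
    have hrest : AN (T (q - zernikeTrunc m N' q)) = 0 := by
      rw [← hANtr]
      have : zernikeTrunc m N (T (q - zernikeTrunc m N' q)) = 0 := by
        ext n
        rw [zernikeTrunc_apply]
        split_ifs with hn
        · refine h2 _ (fun k hk => ?_) n hn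
          rw [lp.coeFn_sub, Pi.sub_apply, zernikeTrunc_apply, if_pos hk, sub_self]
        · rfl
      rw [this, map_zero]
    have hANq : AN h = AN p := (hANtr h).symm
    have hTh : AN (T h) = AN (T p) + AN (T (zernikeTrunc m N' q)) := by
      rw [map_sub, map_sub, sub_eq_zero] at hrest
      rw [← hrest, ← map_add, ← map_add, hq, add_sub_cancel]
    rw [hpq, sub_zero]
    simp only [approxInv, sub_apply, ContinuousLinearMap.comp_apply,
      add_apply, ContinuousLinearMap.id_apply, map_add]
    rw [hANq, hTh, ← hp]
    abel
  rw [hdec]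
  have b1 : ‖p - AN (p + T p)‖ ≤ Z₀ * ‖p‖ := h0 p hpp
  have b2 : ‖AN (T (zernikeTrunc m N' q - zernikeTrunc m N q))‖ ≤ X * ‖q‖ :=
    ContinuousLinearMap.le_of_opNorm_le _ hXT q
  have b3 := h3 h
  have hn := norm_trunc_add_norm_sub N h
  have hM0 : (Z₀ : ℝ) ≤ (max Z₀ X : ℝ≥0) := by exact_mod_cast le_max_left _ _
  have hMX : (X : ℝ) ≤ (max Z₀ X : ℝ≥0) := by exact_mod_cast le_max_right _ _
  calc _ ≤ ‖p - AN (p + T p)‖ + ‖AN (T (zernikeTrunc m N' q - zernikeTrunc m N q))‖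
        + ‖T h - zernikeTrunc m N (T h)‖ :=
        (norm_sub_le _ _).trans (add_le_add_left (norm_sub_le _ _) _)
    _ ≤ (max Z₀ X : ℝ≥0) * ‖p‖ + (max Z₀ X : ℝ≥0) * ‖q‖ + ε * ‖h‖ := by
        gcongr
        · exact b1.trans (by gcongr)
        · exact b2.trans (by gcongr)
    _ = ((max Z₀ X : ℝ≥0) + ε) * ‖h‖ := by rw [← hn]; ring
    _ ≤ Z₁ * ‖h‖ := by gcongr

/-! ### The Fréchet derivative and the two cases of the bound -/

/-- The product rule for the bounded bilinear convolution; commutativity merges its two terms into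
`DG(U)`. -/
theorem hasFDerivAt_add_comp_zernikeG {m m' : ℕ} (S : ZernikeV (m + m) →L[ℂ] ZernikeV m')
    (E : ZernikeV m →L[ℂ] ZernikeV m') (U : ZernikeV m) :
    HasFDerivAt (fun V => E V + S (zernikeG m V)) (E + S ∘L zernikeDGCLM m m U) U := by
  have hid := hasFDerivAt_id (𝕜 := ℂ) U
  have h1 := (zernikeConvCLM m m).hasFDerivAt_of_bilinear hid hid
  have h2 := E.hasFDerivAt.add (S.hasFDerivAt.comp U h1)
  refine h2.congr_fderiv ?_
  ext1 h
  change E h + S (zernikeConv m m U h + zernikeConv m m h U)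
    = E h + S ((2 : ℂ) • zernikeConv m m U h)
  rw [zernikeConv_comm m h U, two_smul]

theorem apply_eq_zero_of_trunc_eq {m N : ℕ} {U : ZernikeV m} (hU : zernikeTrunc m N U = U) (n : ℕ)
    (hn : N < n) : U n = 0 := by
  rw [← hU, zernikeTrunc_apply, if_neg (by omega)]

theorem zernikeDG_apply_eq_zero {m₁ m₂ : ℕ} (a : ZernikeV m₁) (b : ZernikeV m₂) (N K : ℕ)
    (ha : ∀ n, N < n → a n = 0) (hb : ∀ n, n ≤ K + N + m₁ → b n = 0) (n : ℕ) (hn : n ≤ K) :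
    zernikeDG m₁ m₂ a b n = 0 := by
  change (2 : ℂ) * zernikeConv m₁ m₂ a b n = 0
  rw [zernikeConv_apply_eq_zero a b N K ha hb n hn, mul_zero]

/-- The bound `‖I - A DF_m(U₀)‖₁ ≤ Z₁`. -/
theorem mainTheorem5 (N : ℕ) (hN : 1 ≤ N) (Z₀ Z₁ : ℝ≥0) :
    (∀ (m : ℕ) (U₀ : ZernikeV m) (_hU₀ : zernikeTrunc m N U₀ = U₀)
        (AN : ZernikeV m →L[ℂ] ZernikeV m)
        (_hAN : zernikeTrunc m N ∘L AN ∘L zernikeTrunc m N = AN),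
      l1OpNorm (fun h : ZernikeV m =>
          zernikeTrunc m N h - AN (h + linTerm m U₀ (zernikeTrunc m N h))) ≤ Z₀ →
      max (Z₀ : ℝ≥0∞) (l1OpNorm (fun h : ZernikeV m =>
            AN (linTerm m U₀ (zernikeTrunc m (2 * N + m + 1) h - zernikeTrunc m N h))))
          + ENNReal.ofReal (2 * ‖U₀‖ / (2 * ((N : ℝ) + 1) + m) ^ 2) ≤ Z₁ →
      DifferentiableAt ℂ (zernikeF m) U₀ ∧
        ‖ContinuousLinearMap.id ℂ (ZernikeV m)
          - approxInv m N AN ∘L fderiv ℂ (zernikeF m) U₀‖ ≤ Z₁) ∧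
    (∀ (U₀ : ZernikeV 1) (hU₀ : zernikeTrunc 1 N U₀ = U₀)
        (AN : ZernikeV 1 →L[ℂ] ZernikeV 1)
        (_hAN : zernikeTrunc 1 N ∘L AN ∘L zernikeTrunc 1 N = AN),
      l1OpNorm (fun h : ZernikeV 1 =>
          zernikeTrunc 1 N h
            - AN (zernikeTrunc 1 N h + linTermNegOne U₀ (zernikeTrunc 1 N h))) ≤ Z₀ →
      max (Z₀ : ℝ≥0∞) (l1OpNorm (fun h : ZernikeV 1 =>
            AN (invLap 1 (zernikeDG 0 1 (rPlusZeroInv N U₀ hU₀)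
              (zernikeTrunc 1 (2 * N + 1) h - zernikeTrunc 1 N h)))))
          + ENNReal.ofReal (‖rPlusZeroInv N U₀ hU₀‖ / (2 * (N : ℝ) ^ 2)) ≤ Z₁ →
      DifferentiableAt ℂ zernikeFNegOne U₀ ∧
        ‖ContinuousLinearMap.id ℂ (ZernikeV 1)
          - approxInv 1 N AN ∘L fderiv ℂ zernikeFNegOne U₀‖ ≤ Z₁) := by
  constructor
  · intro m U₀ hU₀ AN hAN h0 h1
    let T : ZernikeV m →L[ℂ] ZernikeV m := invLapCLM m ∘L rMinusPowCLM m m ∘L zernikeDGCLM m m U₀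
    have hT : ∀ h, T h = linTerm m U₀ h := fun h => by
      change invLap m (rMinusPowCLM m m _) = _
      rw [rMinusPowCLM_apply]
      rfl
    have hF : HasFDerivAt (zernikeF m) (ContinuousLinearMap.id ℂ (ZernikeV m) + T) U₀ := by
      have := hasFDerivAt_add_comp_zernikeG (invLapCLM m ∘L rMinusPowCLM m m)
        (ContinuousLinearMap.id ℂ (ZernikeV m)) U₀
      refine this.congr_of_eventuallyEq (Filter.Eventually.of_forall fun V => ?_)
      change V + invLap m (rMinusPow m m _) = V + invLap m (rMinusPowCLM m m _)
      rw [rMinusPowCLM_apply]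
    refine ⟨hF.differentiableAt, ?_⟩
    rw [hF.fderiv]
    simp only [← hT] at h0 h1
    refine norm_id_sub_approxInv_comp_le (N' := 2 * N + m + 1) AN T hAN Z₀ Z₁ _
      (by positivity) ?_ h1 ?_ ?_
    -- The assumed bound has `h` where the finite block has `π^N h`; only the case `π^N h = h` is
    -- used.
    · intro h hh
      have := ContinuousLinearMap.le_of_opNorm_le _ (norm_le_of_l1OpNorm_le (zernikeTrunc m N
        - AN ∘L (ContinuousLinearMap.id ℂ (ZernikeV m) + T ∘L zernikeTrunc m N)) Z₀ h0) h
      change ‖zernikeTrunc m N h - AN (h + T (zernikeTrunc m N h))‖ ≤ _ at this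
      rwa [hh] at this
    -- The index drops by at most one under `Δ₀⁻¹`, by none under `R⁻`, and by at most `N + m` under
    -- multiplication by `U₀`, so `N' = N + (N + m) + 1`.
    · intro h hh n hn
      rw [hT]
      refine invLap_apply_eq_zero m N _ (fun i hi => rMinusPow_apply_eq_zero m m (N + 1) _
        (fun j hj => ?_) i hi) n hn
      exact zernikeDG_apply_eq_zero U₀ h N (N + 1) (apply_eq_zero_of_trunc_eq hU₀)
        (fun k hk => hh k (by omega)) j hj
    · intro h
      rw [hT]
      refine (norm_invLap_sub_trunc_le m N hN _).trans ?_
      rw [div_mul_eq_mul_div, one_mul, div_mul_eq_mul_div]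
      gcongr
      exact (norm_rMinusPow_le m m _).trans (norm_zernikeDG_le U₀ h)
  · intro U₀ hU₀ AN hAN h0 h1
    set W := rPlusZeroInv N U₀ hU₀ with hW
    let T : ZernikeV 1 →L[ℂ] ZernikeV 1 := invLapCLM 1 ∘L zernikeDGCLM 0 1 W
    have hT : ∀ h, T h = linTermNegOne U₀ h := fun h =>
      (linTermNegOne_eq U₀ W (rPlusSeq_rPlusZeroInv N U₀ hU₀) h).symm
    have hT' : ∀ h, T h = invLap 1 (zernikeDG 0 1 W h) := fun h => rfl
    have hF : HasFDerivAt zernikeFNegOne (ContinuousLinearMap.id ℂ (ZernikeV 1) + T) U₀ := by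
      -- The derivative is first obtained through `U₀`, then rewritten through `W`.
      have := hasFDerivAt_add_comp_zernikeG (m := 1) invLapRPlusOneInvCLM
        (ContinuousLinearMap.id ℂ (ZernikeV 1)) U₀
      refine this.congr_fderiv ?_
      ext1 h
      change h + linTermNegOne U₀ h = h + T h
      rw [hT]
    refine ⟨hF.differentiableAt, ?_⟩
    rw [hF.fderiv]
    simp only [← hT] at h0
    -- The inverse matrix is upper triangular, so the support of `W` stays within the indices up to
    -- `N`.
    have hWN : ∀ n, N < n → W n = 0 := fun i hi => by
      change ∑' j, rPlusZeroInvMat i j * U₀ j = 0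
      refine (tsum_congr fun j => ?_).trans tsum_zero
      by_cases h : i ≤ j
      · rw [apply_eq_zero_of_trunc_eq hU₀ j (by omega), mul_zero]
      · rw [rPlusZeroInvMat, if_neg h, zero_mul]
    refine norm_id_sub_approxInv_comp_le (N' := 2 * N + 1) AN T hAN Z₀ Z₁ _
      (by positivity) ?_ h1 ?_ ?_
    · intro h hh
      have := ContinuousLinearMap.le_of_opNorm_le _ (norm_le_of_l1OpNorm_le
        (zernikeTrunc 1 N - AN ∘L (zernikeTrunc 1 N + T ∘L zernikeTrunc 1 N)) Z₀ h0) h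
      change ‖zernikeTrunc 1 N h - AN (zernikeTrunc 1 N h + T (zernikeTrunc 1 N h))‖ ≤ _ at this
      rwa [hh] at this
    · intro h hh n hn
      refine invLap_apply_eq_zero 1 N _ (fun i hi => ?_) n hn
      exact zernikeDG_apply_eq_zero W h N (N + 1) hWN (fun k hk => hh k (by omega)) i hi
    · intro h
      have hNr : (1 : ℝ) ≤ N := by exact_mod_cast hN
      rw [hT']
      refine (norm_invLap_sub_trunc_le 1 N hN _).trans ?_
      refine (mul_le_mul_of_nonneg_left (norm_zernikeDG_le W h) (by positivity)).trans ?_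
      -- The tail bound for wave number `1` is weakened to `1 / (2N)^2`; the factor `2` in `DG(W)`
      -- then gives the stated `1 / (2 N^2)`.
      have : 1 / (2 * ((N : ℝ) + 1) + (1 : ℕ)) ^ 2 ≤ 1 / (4 * (N : ℝ) ^ 2) := by
        refine one_div_le_one_div_of_le (by positivity) ?_
        push_cast
        nlinarith
      calc _ ≤ 1 / (4 * (N : ℝ) ^ 2) * (2 * ‖W‖ * ‖h‖) := by gcongr
        _ = _ := by field_simp; ring

end
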